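/- Let $\alpha>0$. For $0<a<1$ let $w(x,a)=(1-x^2)^{\alpha}\bigl(1-\chi_{(-a,a)}(x)\bigr)$ on $[-1,1]$, where $\chi_{(-a,a)}$ is the indicator function of $(-a,a)$. Let $P_n(x,a)$, $n=0,1,2,\dots$, be the monic polynomials in $x$ of degree $n$ with $$\int_{-1}^1P_j(x,a)P_k(x,a)w(x,a)\,dx=h_j(a)\delta_{jk},$$ and for $n\ge1$ put $$r_n(a)=\frac{2P_n(a,a)P_{n-1}(a,a)(1-a^2)^\alpha}{h_{n-1}(a)}.$$ (1) For every integer $n\ge 1$ the function $r_n$ is twice continuously differentiable on $(0,1)$ and satisfies there the second order differential equation, quadratic in $r_n''$, $$\begin{aligned} &a^2(a^2-1)^4(r_n'')^2+4a^2(a^2-1)^2\bigl[a(a^2-1)r_n'+4r_n^3+6(\alpha+n)r_n^2+2n(2\alpha+n)r_n\bigr]r_n''\\ &-4(a^2-1)^2\bigl[(a^2+1)^2r_n^2+2(a^2+1)a^2(\alpha+n)r_n+a^4(\alpha+n-1)(\alpha+n+1)\bigr](r_n')^2\\ &+16a^3(a^2-1)\bigl[2r_n^3+3(\alpha+n)r_n^2+n(2\alpha+n)r_n\bigr]r_n'-16(a^2-1)^2r_n^6\\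 &-32(2a^4-3a^2+1)(\alpha+n)r_n^5-16(a^2-1)\bigl[5a^2\alpha^2+(6a^2-1)(n^2+2\alpha n)\bigr]r_n^4\\ &-32a^2(\alpha+n)\bigl[a^2\alpha^2+(a^2-1)(2n^2+4\alpha n)\bigr]r_n^3\\ &-16a^2n(2\alpha+n)\bigl[a^2\alpha^2+(a^2-1)(n^2+2\alpha n)\bigr]r_n^2=0 . \end{aligned}$$ (2) This equation can be transformed to the fourth member of the Chazy II system. Explicitly, let $N=n+\alpha$. A twice continuously differentiable function $f:(0,1)\to\mathbb R$ satisfies the equation in (1) (with $f$ in place of $r_n$) on $(0,1)$ if and only if the function $y(x)=i\bigl(f(\tanh\tfrac x2)+\tfrac N2\bigr)$ satisfies, for all $x>0$, $$\bigl(y''-2y^3-c_1y-c_2\bigr)^2=-4\,(y\coth x-\kappa\,\mathrm{csch}\,x)^2\bigl((y')^2-y^4-c_1y^2-2c_2y-c_3\bigr),$$ where $c_1=\tfrac{N^2}{2}+\alpha^2$, $c_2=-\tfrac{i}{2}N\alpha^2$, $c_3=\tfrac1{16}N^2(N^2-4\alpha^2)$ and $\kappa=\tfrac i2N$. -/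

import Mathlib

open Set MeasureTheory Polynomial

noncomputable section

namespace JacobiGap

/-- The weight `(1 - x ^ 2) ^ α` with the interval `(-a, a)` removed. -/
def weight (α a x : ℝ) : ℝ :=
  (1 - x ^ 2) ^ α * (1 - (Ioo (-a) a).indicator (fun _ => (1 : ℝ)) x)

/-- The bilinear form `∫_{-1}^{1} p(x) q(x) w(x, a) dx` on polynomials. -/
def pairing (α a : ℝ) (p q : ℝ[X]) : ℝ :=
  ∫ x in (-1 : ℝ)..1, p.eval x * q.eval x * weight α a x

/-- The monic orthogonal polynomials `P_n(x, a)`, built from the powers of `x` by the Gram-Schmidt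
process; `orthPoly_monic`, `orthPoly_natDegree` and `pairing_orthPoly` below verify their defining
properties. -/
def orthPoly (α a : ℝ) (n : ℕ) : ℝ[X] :=
  X ^ n - ∑ k : Fin n,
    C (pairing α a (X ^ n) (orthPoly α a k) /
      pairing α a (orthPoly α a k) (orthPoly α a k)) * orthPoly α a k
termination_by n
decreasing_by all_goals exact k.2

/-- The squared norm `h_n(a) = ∫_{-1}^{1} P_n(x, a) ^ 2 w(x, a) dx`. -/
def normSq (α a : ℝ) (n : ℕ) : ℝ := pairing α a (orthPoly α a n) (orthPoly α a n)

/-- `r_n(a) = 2 P_n(a, a) P_{n-1}(a, a) (1 - a ^ 2) ^ α / h_{n-1}(a)`, for `n ≥ 1`. -/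
def r (α : ℝ) (n : ℕ) (a : ℝ) : ℝ :=
  2 * (orthPoly α a n).eval a * (orthPoly α a (n - 1)).eval a * (1 - a ^ 2) ^ α /
    normSq α a (n - 1)

/-- The second order differential equation at the point `a`, for a function with value `y`, first
derivative `y₁` and second derivative `y₂` there. -/
def SecondOrderODE (α n a y y₁ y₂ : ℝ) : Prop :=
  a ^ 2 * (a ^ 2 - 1) ^ 4 * y₂ ^ 2
  + 4 * a ^ 2 * (a ^ 2 - 1) ^ 2 *
      (a * (a ^ 2 - 1) * y₁ + 4 * y ^ 3 + 6 * (α + n) * y ^ 2 + 2 * n * (2 * α + n) * y) * y₂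
  - 4 * (a ^ 2 - 1) ^ 2 *
      ((a ^ 2 + 1) ^ 2 * y ^ 2 + 2 * (a ^ 2 + 1) * a ^ 2 * (α + n) * y
        + a ^ 4 * (α + n - 1) * (α + n + 1)) * y₁ ^ 2
  + 16 * a ^ 3 * (a ^ 2 - 1) *
      (2 * y ^ 3 + 3 * (α + n) * y ^ 2 + n * (2 * α + n) * y) * y₁
  - 16 * (a ^ 2 - 1) ^ 2 * y ^ 6
  - 32 * (2 * a ^ 4 - 3 * a ^ 2 + 1) * (α + n) * y ^ 5
  - 16 * (a ^ 2 - 1) *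
      (5 * a ^ 2 * α ^ 2 + (6 * a ^ 2 - 1) * (n ^ 2 + 2 * α * n)) * y ^ 4
  - 32 * a ^ 2 * (α + n) *
      (a ^ 2 * α ^ 2 + (a ^ 2 - 1) * (2 * n ^ 2 + 4 * α * n)) * y ^ 3
  - 16 * a ^ 2 * n * (2 * α + n) *
      (a ^ 2 * α ^ 2 + (a ^ 2 - 1) * (n ^ 2 + 2 * α * n)) * y ^ 2
  = 0

/-- The fourth member of the Chazy II system, in hyperbolic form and with parameters
`c₁ c₂ c₃ κ`, at the point `x`. -/
def ChazyIIFourth (c₁ c₂ c₃ κ : ℂ) (y : ℝ → ℂ) (x : ℝ) : Prop :=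
  (deriv (deriv y) x - 2 * y x ^ 3 - c₁ * y x - c₂) ^ 2 =
    -4 * ((y x * (Real.cosh x : ℂ) - κ) / (Real.sinh x : ℂ)) ^ 2 *
      (deriv y x ^ 2 - y x ^ 4 - c₁ * y x ^ 2 - 2 * c₂ * y x - c₃)

/-! The polynomials `orthPoly` are monic, of degree `n`, and orthogonal. -/

theorem orthPoly_eq (α a : ℝ) (n : ℕ) :
    orthPoly α a n = X ^ n - ∑ k : Fin n,
      C (pairing α a (X ^ n) (orthPoly α a k) / normSq α a k) * orthPoly α a k := by
  rw [orthPoly]; rfl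

theorem orthPoly_monic_natDegree (α a : ℝ) (n : ℕ) :
    (orthPoly α a n).Monic ∧ (orthPoly α a n).natDegree = n := by
  induction n using Nat.strong_induction_on with
  | _ n ih =>
    have hlt : (∑ k : Fin n, C (pairing α a (X ^ n) (orthPoly α a k) / normSq α a k) *
        orthPoly α a k).degree < (n : WithBot ℕ) := by
      rw [← Polynomial.mem_degreeLT]
      refine Submodule.sum_mem _ fun k _ => ?_
      rw [Polynomial.mem_degreeLT]
      rw [← Polynomial.smul_eq_C_mul]
      refine lt_of_le_of_lt (Polynomial.degree_smul_le _ _) ?_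
      rw [Polynomial.degree_eq_natDegree (ih k k.2).1.ne_zero, (ih k k.2).2]
      exact_mod_cast k.2
    rw [orthPoly_eq]
    have hm := (Polynomial.monic_X_pow (R := ℝ) n).sub_of_left (by simpa using hlt)
    refine ⟨hm, ?_⟩
    apply Polynomial.natDegree_eq_of_degree_eq_some
    rw [Polynomial.degree_sub_eq_left_of_degree_lt (by simpa using hlt), Polynomial.degree_X_pow]

theorem orthPoly_monic (α a : ℝ) (n : ℕ) : (orthPoly α a n).Monic :=
  (orthPoly_monic_natDegree α a n).1

theorem orthPoly_natDegree (α a : ℝ) (n : ℕ) : (orthPoly α a n).natDegree = n :=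
  (orthPoly_monic_natDegree α a n).2

theorem weight_nonneg (α a : ℝ) {x : ℝ} (hx : x ∈ Icc (-1 : ℝ) 1) : 0 ≤ weight α a x := by
  unfold weight
  have h1 : 0 ≤ 1 - x ^ 2 := by nlinarith [hx.1, hx.2]
  refine mul_nonneg (Real.rpow_nonneg h1 _) ?_
  by_cases h : x ∈ Ioo (-a) a <;> simp [h]

theorem intervalIntegrable_poly_weight {α : ℝ} (hα : 0 < α) (a : ℝ) (p : ℝ[X]) :
    IntervalIntegrable (fun x => p.eval x * weight α a x) volume (-1) 1 := by
  have hc : Continuous fun x : ℝ => p.eval x * (1 - x ^ 2) ^ α :=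
    p.continuous.mul ((by fun_prop : Continuous fun x : ℝ => 1 - x ^ 2).rpow_const
      fun _ => Or.inr hα.le)
  have h0 := hc.intervalIntegrable (μ := volume) (-1) 1
  rw [intervalIntegrable_iff] at h0 ⊢
  have h1 := h0.sub (h0.indicator (measurableSet_Ioo (a := -a) (b := a)))
  refine h1.congr (Filter.Eventually.of_forall fun x => ?_)
  by_cases h : x ∈ Ioo (-a) a <;> simp [weight, h]

theorem pairing_integrable {α : ℝ} (hα : 0 < α) (a : ℝ) (p q : ℝ[X]) :
    IntervalIntegrable (fun x => p.eval x * q.eval x * weight α a x) volume (-1) 1 := by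
  simpa using intervalIntegrable_poly_weight hα a (p * q)

theorem pairing_comm (α a : ℝ) (p q : ℝ[X]) : pairing α a p q = pairing α a q p := by
  simp only [pairing, mul_comm (p.eval _)]

theorem pairing_sub_left {α : ℝ} (hα : 0 < α) (a : ℝ) (p q s : ℝ[X]) :
    pairing α a (p - q) s = pairing α a p s - pairing α a q s := by
  unfold pairing
  rw [← intervalIntegral.integral_sub (pairing_integrable hα a p s) (pairing_integrable hα a q s)]
  congr 1; ext x; simp; ring

theorem pairing_sum_left {α : ℝ} (hα : 0 < α) (a : ℝ) {ι : Type*} (t : Finset ι) (c : ι → ℝ)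
    (p : ι → ℝ[X]) (s : ℝ[X]) :
    pairing α a (∑ i ∈ t, C (c i) * p i) s = ∑ i ∈ t, c i * pairing α a (p i) s := by
  unfold pairing
  simp_rw [← intervalIntegral.integral_const_mul]
  rw [← intervalIntegral.integral_finsetSum fun i _ => (pairing_integrable hα a (p i) s).const_mul _]
  congr 1; ext x
  rw [Polynomial.eval_finsetSum, Finset.sum_mul, Finset.sum_mul]
  exact Finset.sum_congr rfl fun i _ => by simp; ring

theorem pairing_self_pos {α a : ℝ} (hα : 0 < α) (ha : a ∈ Ioo (0 : ℝ) 1) {p : ℝ[X]}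
    (hp : p ≠ 0) : 0 < pairing α a p p := by
  unfold pairing
  rw [intervalIntegral.integral_pos_iff_support_of_nonneg_ae' _ (pairing_integrable hα a p p)]
  · refine ⟨by norm_num, ?_⟩
    have hsub : Ioo a 1 \ (p.roots.toFinset : Set ℝ) ⊆
        Function.support (fun x => p.eval x * p.eval x * weight α a x) ∩ Ioc (-1) 1 := by
      rintro x ⟨hx, hxr⟩
      have h1 : p.eval x ≠ 0 := by
        intro h0; apply hxr; simp [hp, h0]
      have h2 : (0 : ℝ) < 1 - x ^ 2 := by nlinarith [hx.1, hx.2, ha.1]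
      have h3 : x ∉ Ioo (-a) a := fun h => absurd h.2 (not_lt.2 hx.1.le)
      refine ⟨?_, by linarith [hx.1, ha.1], hx.2.le⟩
      simp [weight, h3, h1, (Real.rpow_pos_of_pos h2 α).ne']
    refine lt_of_lt_of_le ?_ (measure_mono hsub)
    rw [measure_sdiff_null (Finset.measure_zero _ _), Real.volume_Ioo]
    simpa using ha.2
  · rw [uIoc_of_le (by norm_num)]
    refine (ae_restrict_iff' measurableSet_Ioc).2 (Filter.Eventually.of_forall fun x hx => ?_)
    exact mul_nonneg (mul_self_nonneg _) (weight_nonneg α a ⟨hx.1.le, hx.2⟩)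

theorem normSq_pos {α a : ℝ} (hα : 0 < α) (ha : a ∈ Ioo (0 : ℝ) 1) (n : ℕ) :
    0 < normSq α a n :=
  pairing_self_pos hα ha (orthPoly_monic α a n).ne_zero

theorem pairing_orthPoly_of_lt {α a : ℝ} (hα : 0 < α) (ha : a ∈ Ioo (0 : ℝ) 1) (n : ℕ) :
    ∀ j < n, pairing α a (orthPoly α a n) (orthPoly α a j) = 0 := by
  induction n using Nat.strong_induction_on with
  | _ n ih =>
    intro j hj
    rw [orthPoly_eq, pairing_sub_left hα, pairing_sum_left hα,
      Finset.sum_eq_single (⟨j, hj⟩ : Fin n)]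
    · have := (normSq_pos hα ha j).ne'
      simp only
      rw [← normSq, div_mul_cancel₀ _ this, sub_self]
    · intro k _ hk
      have hne : (k : ℕ) ≠ j := fun h => hk (Fin.ext h)
      rcases lt_or_gt_of_ne hne with h | h
      · rw [pairing_comm α a (orthPoly α a k) (orthPoly α a j), ih j hj k h, mul_zero]
      · rw [ih k k.2 j h, mul_zero]
    · simp

/-- Orthogonality: `∫_{-1}^{1} P_j P_k w dx = h_j δ_{jk}`. -/
theorem pairing_orthPoly {α a : ℝ} (hα : 0 < α) (ha : a ∈ Ioo (0 : ℝ) 1) (j k : ℕ) :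
    pairing α a (orthPoly α a j) (orthPoly α a k) = if j = k then normSq α a j else 0 := by
  split_ifs with h
  · subst h; rfl
  · rcases lt_or_gt_of_ne h with h | h
    · rw [pairing_comm]; exact pairing_orthPoly_of_lt hα ha k j h
    · exact pairing_orthPoly_of_lt hα ha j k h

end JacobiGap

end

/-! The only non-classical features of the weight are the two endpoints `±a`, so integration by
parts in `x` and differentiation in `a` produce the usual Jacobi terms plus boundary terms at `±a`.
Boundary terms are evaluations, which Christoffel-Darboux kernels represent. This gives
`orthPoly_structure_relation` (the `x`-derivative of `P_n`) and `hasPolyDerivAt_orthPoly` (the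
`a`-derivative).

For `n = m + 1` let `y = r_n`, `X = upperResidue`, `R = lowerResidue`, `β = h_{m+1} / h_m`. These
satisfy a closed first order differential system together with two algebraic relations: `X R = y ^
2`, immediate from the definitions, and `residue_relation`, a vanishing determinant obtained by
putting `x = 1` in the structure relation.

With `N = n + α`, `A = 2N + 1`, `B = 2N - 1`, the system says `(1 - a^2) y' = AβR - BX`. Put `V =
AβR + BX + 2ay^2`. The algebraic relations express `V ^ 2` through `y` and `y'`; differentiating
once more gives an equation linear in `V` with coefficient `E = 2Na^2 + 2(1 + a^2)y`. Isolating `E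
V` and squaring yields the second order equation.

The Chazy form is this same squared equation: for `a = tanh (x/2)` and `u = y + N/2`, the factor `u
coth x - (N/2) csch x` is `E / (4a)`, and the last factor is `V^2 / 4`, its quartic part being `y^2
((y + N)^2 - α^2)` written in `u`. -/

noncomputable section

namespace JacobiGap

/-! ### The moment functional: dependence on `a`, integration by parts, parity. -/

/-- The linear functional `p ↦ ∫_{-1}^{1} p(x) w(x, a) dx` on polynomials. -/
def momentFunctional {α : ℝ} (hα : 0 < α) (a : ℝ) : ℝ[X] →ₗ[ℝ] ℝ where
  toFun p := ∫ x in (-1 : ℝ)..1, p.eval x * weight α a x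
  map_add' p q := by
    rw [← intervalIntegral.integral_add (intervalIntegrable_poly_weight hα a p)
      (intervalIntegrable_poly_weight hα a q)]
    congr 1; ext x; simp; ring
  map_smul' c p := by
    simp only [eval_smul, smul_eq_mul, mul_assoc, intervalIntegral.integral_const_mul,
      RingHom.id_apply]

theorem momentFunctional_apply {α : ℝ} (hα : 0 < α) (a : ℝ) (p : ℝ[X]) :
    momentFunctional hα a p = ∫ x in (-1 : ℝ)..1, p.eval x * weight α a x := rfl

theorem pairing_eq_momentFunctional {α : ℝ} (hα : 0 < α) (a : ℝ) (p q : ℝ[X]) :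
    pairing α a p q = momentFunctional hα a (p * q) := by
  simp [pairing, momentFunctional_apply]

theorem momentFunctional_C_mul {α : ℝ} (hα : 0 < α) (a c : ℝ) (p : ℝ[X]) :
    momentFunctional hα a (C c * p) = c * momentFunctional hα a p := by
  rw [← smul_eq_C_mul, map_smul, smul_eq_mul]

theorem continuous_poly_mul_rpow {α : ℝ} (hα : 0 < α) (p : ℝ[X]) :
    Continuous fun x : ℝ => p.eval x * (1 - x ^ 2) ^ α :=
  p.continuous.mul ((by fun_prop : Continuous fun x : ℝ => 1 - x ^ 2).rpow_const
      fun _ => Or.inr hα.le)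

theorem momentFunctional_eq_sub {α a : ℝ} (hα : 0 < α) (ha : a ∈ Ioo (0 : ℝ) 1) (p : ℝ[X]) :
    momentFunctional hα a p = (∫ x in (-1 : ℝ)..1, p.eval x * (1 - x ^ 2) ^ α) -
      ∫ x in (-a)..a, p.eval x * (1 - x ^ 2) ^ α := by
  have hc := continuous_poly_mul_rpow hα p
  have hle : (-1 : ℝ) ≤ 1 := by norm_num
  have hle' : -a ≤ a := by linarith [ha.1]
  have hsub : Ioo (-a) a ⊆ Ioc (-1 : ℝ) 1 := fun x hx =>
    ⟨by linarith [hx.1, ha.2], by linarith [hx.2, ha.2]⟩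
  have hI := (hc.intervalIntegrable (μ := volume) (-1) 1)
  rw [intervalIntegrable_iff_integrableOn_Ioc_of_le hle] at hI
  rw [momentFunctional_apply, intervalIntegral.integral_of_le hle,
    intervalIntegral.integral_of_le hle, intervalIntegral.integral_of_le hle',
    integral_Ioc_eq_integral_Ioo (x := -a) (y := a)]
  rw [← inter_eq_self_of_subset_right hsub, ← setIntegral_indicator measurableSet_Ioo,
    ← integral_sub hI (hI.indicator measurableSet_Ioo)]
  congr 1; ext x
  by_cases h : x ∈ Ioo (-a) a <;> simp [weight, h]

/-- Only the removed integral over `(-a, a)` depends on `a`, and both of its endpoints move. -/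
theorem hasDerivAt_momentFunctional {α a : ℝ} (hα : 0 < α) (ha : a ∈ Ioo (0 : ℝ) 1) (p : ℝ[X]) :
    HasDerivAt (fun b => momentFunctional hα b p)
      (-((p.eval a + p.eval (-a)) * (1 - a ^ 2) ^ α)) a := by
  have hc := continuous_poly_mul_rpow hα p
  set g := fun x : ℝ => p.eval x * (1 - x ^ 2) ^ α with hg
  have hF : ∀ u, HasDerivAt (fun u => ∫ x in (0 : ℝ)..u, g x) (g u) u := fun u =>
    intervalIntegral.integral_hasDerivAt_right (hc.intervalIntegrable _ _)
      (hc.stronglyMeasurableAtFilter _ _) hc.continuousAt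
  have h1 := ((hasDerivAt_const a (∫ x in (-1 : ℝ)..1, g x)).sub
    ((hF a).sub ((hF (-a)).comp a (hasDerivAt_neg a))))
  refine (h1.congr_of_eventuallyEq ?_).congr_deriv ?_
  · filter_upwards [isOpen_Ioo.mem_nhds ha] with b hb
    rw [momentFunctional_eq_sub hα hb]
    simp only [Pi.sub_apply, Function.comp]
    rw [intervalIntegral.integral_interval_sub_left (hc.intervalIntegrable _ _)
      (hc.intervalIntegrable _ _)]
  · simp only [hg, neg_sq]; ring

/-- The left integrand is the derivative of `p(x) (1 - x^2)^(α+1)`. Raising the exponent by one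
makes this primitive differentiable up to `±1` and zero there, so only the cuts `±a` contribute. -/
theorem momentFunctional_integration_by_parts {α a : ℝ} (hα : 0 < α) (ha : a ∈ Ioo (0 : ℝ) 1)
    (p : ℝ[X]) :
    momentFunctional hα a ((1 - X ^ 2) * derivative p - C (2 * (α + 1)) * X * p) =
      -((1 - a ^ 2) * (1 - a ^ 2) ^ α * (p.eval a - p.eval (-a))) := by
  set q := (1 - X ^ 2) * derivative p - C (2 * (α + 1)) * X * p with hq
  have hc := continuous_poly_mul_rpow hα q
  have hd : ∀ x ∈ Icc (-1 : ℝ) 1, HasDerivAt (fun x : ℝ => p.eval x * (1 - x ^ 2) ^ (α + 1))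
      (q.eval x * (1 - x ^ 2) ^ α) x := by
    intro x hx
    have h0 : 0 ≤ 1 - x ^ 2 := by nlinarith [hx.1, hx.2]
    have h1 : HasDerivAt (fun x : ℝ => 1 - x ^ 2) (-(2 * x)) x := by
      simpa using ((hasDerivAt_pow 2 x).const_sub 1)
    refine ((p.hasDerivAt x).mul (h1.rpow_const (p := α + 1) (Or.inr (by linarith)))).congr_deriv ?_
    rw [Real.rpow_add_one' h0 (by linarith), add_sub_cancel_right, hq]
    simp; ring
  have hI : ∀ u v : ℝ, u ∈ Icc (-1 : ℝ) 1 → v ∈ Icc (-1 : ℝ) 1 →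
      ∫ x in u..v, q.eval x * (1 - x ^ 2) ^ α =
        p.eval v * (1 - v ^ 2) ^ (α + 1) - p.eval u * (1 - u ^ 2) ^ (α + 1) := fun u v hu hv =>
    intervalIntegral.integral_eq_sub_of_hasDerivAt
      (fun x hx => hd x (uIcc_subset_Icc hu hv hx)) (hc.intervalIntegrable _ _)
  have hα1 : α + 1 ≠ 0 := by linarith
  have hw : 0 ≤ 1 - a ^ 2 := by nlinarith [ha.1, ha.2]
  rw [momentFunctional_eq_sub hα ha, hI _ _ (by norm_num) (by norm_num),
    hI _ _ ⟨by linarith [ha.2], by linarith [ha.1]⟩ ⟨by linarith [ha.1], ha.2.le⟩]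
  simp only [neg_sq, one_pow, sub_self, Real.zero_rpow hα1, Real.rpow_add_one' hw hα1]
  ring

theorem momentFunctional_comp_neg_X {α : ℝ} (hα : 0 < α) (a : ℝ) (p : ℝ[X]) :
    momentFunctional hα a (p.comp (-X)) = momentFunctional hα a p := by
  rw [momentFunctional_apply, momentFunctional_apply]
  have h := intervalIntegral.integral_comp_neg (a := -1) (b := 1)
    (fun x : ℝ => p.eval x * weight α a x)
  rw [neg_neg] at h
  rw [← h]
  congr 1; ext x
  have : weight α a (-x) = weight α a x := by
    have hx : -x ∈ Ioo (-a) a ↔ x ∈ Ioo (-a) a := by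
      simp only [mem_Ioo]; constructor <;> rintro ⟨h1, h2⟩ <;> constructor <;> linarith
    by_cases hm : x ∈ Ioo (-a) a
    · simp [weight, hm, hx.2 hm]
    · simp [weight, hm, mt hx.1 hm]
  simp [this]

theorem momentFunctional_eq_zero_of_odd {α : ℝ} (hα : 0 < α) (a : ℝ) {p : ℝ[X]}
    (hp : p.comp (-X) = -p) : momentFunctional hα a p = 0 := by
  have h := momentFunctional_comp_neg_X hα a p
  rw [hp, map_neg] at h
  linarith

/-! ### Orthogonality, three term recurrence and Christoffel-Darboux kernel. -/

theorem orthPoly_degree (α a : ℝ) (n : ℕ) : (orthPoly α a n).degree = n := by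
  rw [degree_eq_natDegree (orthPoly_monic α a n).ne_zero, orthPoly_natDegree]

theorem orthPoly_coeff_self (α a : ℝ) (n : ℕ) : (orthPoly α a n).coeff n = 1 := by
  have h := orthPoly_monic α a n
  rwa [Monic, leadingCoeff, orthPoly_natDegree] at h

theorem orthPoly_coeff_of_lt (α a : ℝ) {n i : ℕ} (h : n < i) : (orthPoly α a n).coeff i = 0 :=
  coeff_eq_zero_of_natDegree_lt (by rwa [orthPoly_natDegree])

theorem orthPoly_zero (α a : ℝ) : orthPoly α a 0 = 1 := by
  rw [orthPoly_eq]; simp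

theorem degree_sub_C_coeff_mul_orthPoly_lt (α a : ℝ) {m : ℕ} {q : ℝ[X]}
    (hq : q.degree < ((m + 1 : ℕ) : WithBot ℕ)) :
    (q - C (q.coeff m) * orthPoly α a m).degree < m := by
  rw [degree_lt_iff_coeff_zero] at hq ⊢
  intro i hi
  rcases hi.eq_or_lt with rfl | hi
  · simp [orthPoly_coeff_self]
  · simp [hq i hi, orthPoly_coeff_of_lt α a hi]

section

variable {α : ℝ} (hα : 0 < α) {a : ℝ}

theorem momentFunctional_mul_eq_zero_of_degree_lt {m : ℕ} {p : ℝ[X]}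
    (hp : ∀ k < m, momentFunctional hα a (p * orthPoly α a k) = 0) {q : ℝ[X]}
    (hq : q.degree < m) : momentFunctional hα a (p * q) = 0 := by
  induction m generalizing q with
  | zero =>
    have : q = 0 := by simpa using hq
    simp [this]
  | succ m ih =>
    have h1 := ih (fun k hk => hp k (by omega)) (degree_sub_C_coeff_mul_orthPoly_lt α a hq)
    rw [mul_sub, map_sub, mul_left_comm, momentFunctional_C_mul, hp m (by omega)] at h1
    linarith

/-- Positive definiteness. Parity, the recurrence, the structure relation and the `a`-derivative of
`P_n` are all proved by this criterion: bound the degree of the difference of the two sides and test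
it against the lower `P_k`. -/
theorem eq_zero_of_momentFunctional_mul_orthPoly (ha : a ∈ Ioo (0 : ℝ) 1) {m : ℕ} {p : ℝ[X]}
    (hd : p.degree < m) (hp : ∀ k < m, momentFunctional hα a (p * orthPoly α a k) = 0) :
    p = 0 := by
  by_contra h
  have h1 := pairing_self_pos hα ha h
  rw [pairing_eq_momentFunctional hα, momentFunctional_mul_eq_zero_of_degree_lt hα hp hd] at h1
  exact h1.false

theorem momentFunctional_orthPoly_mul_orthPoly (ha : a ∈ Ioo (0 : ℝ) 1) (j k : ℕ) :
    momentFunctional hα a (orthPoly α a j * orthPoly α a k) =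
      if j = k then normSq α a j else 0 := by
  rw [← pairing_eq_momentFunctional, pairing_orthPoly hα ha]

theorem momentFunctional_orthPoly_mul (ha : a ∈ Ioo (0 : ℝ) 1) {m : ℕ} {q : ℝ[X]}
    (hq : q.degree < ((m + 1 : ℕ) : WithBot ℕ)) :
    momentFunctional hα a (orthPoly α a m * q) = q.coeff m * normSq α a m := by
  have h1 := momentFunctional_mul_eq_zero_of_degree_lt hα (p := orthPoly α a m) (a := a)
    (fun k hk => by rw [momentFunctional_orthPoly_mul_orthPoly hα ha, if_neg (by omega)])
    (degree_sub_C_coeff_mul_orthPoly_lt α a hq)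
  rw [mul_sub, map_sub, mul_left_comm, momentFunctional_C_mul,
    momentFunctional_orthPoly_mul_orthPoly hα ha, if_pos rfl] at h1
  linarith

theorem momentFunctional_orthPoly_mul_of_degree_lt (ha : a ∈ Ioo (0 : ℝ) 1) {m : ℕ} {q : ℝ[X]}
    (hq : q.degree < m) : momentFunctional hα a (orthPoly α a m * q) = 0 := by
  rw [momentFunctional_orthPoly_mul hα ha (hq.trans (by exact_mod_cast m.lt_succ_self)),
    coeff_eq_zero_of_degree_lt hq, zero_mul]

include hα in
theorem orthPoly_comp_neg_X (ha : a ∈ Ioo (0 : ℝ) 1) (m : ℕ) :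
    (orthPoly α a m).comp (-X) = C ((-1) ^ m) * orthPoly α a m := by
  have hcoeff : ∀ (p : ℝ[X]) (i : ℕ), (p.comp (-X)).coeff i = p.coeff i * (-1) ^ i := by
    intro p i
    rw [show (-X : ℝ[X]) = C (-1) * X by simp, comp_C_mul_X_coeff]
  rw [← sub_eq_zero]
  refine eq_zero_of_momentFunctional_mul_orthPoly hα ha (m := m) ?_ fun k hk => ?_
  · rw [degree_lt_iff_coeff_zero]
    intro i hi
    rw [coeff_sub, hcoeff, coeff_C_mul]
    rcases hi.eq_or_lt with rfl | hi
    · ring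
    · simp [orthPoly_coeff_of_lt α a hi]
  · have h1 : momentFunctional hα a ((orthPoly α a m).comp (-X) * orthPoly α a k) =
        momentFunctional hα a (orthPoly α a m * (orthPoly α a k).comp (-X)) := by
      rw [← momentFunctional_comp_neg_X hα a (orthPoly α a m * (orthPoly α a k).comp (-X)),
        mul_comp, comp_assoc, neg_comp, X_comp, neg_neg, comp_X]
    rw [sub_mul, map_sub, h1, mul_assoc, momentFunctional_C_mul,
      momentFunctional_orthPoly_mul_orthPoly hα ha, if_neg (by omega),
      momentFunctional_orthPoly_mul_of_degree_lt hα ha]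
    · simp
    · rw [degree_lt_iff_coeff_zero]
      intro i hi
      rw [hcoeff, orthPoly_coeff_of_lt α a (by omega), zero_mul]

include hα in
theorem orthPoly_eval_neg (ha : a ∈ Ioo (0 : ℝ) 1) (m : ℕ) (x : ℝ) :
    (orthPoly α a m).eval (-x) = (-1) ^ m * (orthPoly α a m).eval x := by
  have h := congrArg (eval x) (orthPoly_comp_neg_X hα ha m)
  simpa using h

/-- Evenness of the weight removes the diagonal term of the recurrence. -/
theorem momentFunctional_X_mul_orthPoly_sq (ha : a ∈ Ioo (0 : ℝ) 1) (m : ℕ) :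
    momentFunctional hα a (X * (orthPoly α a m * orthPoly α a m)) = 0 := by
  apply momentFunctional_eq_zero_of_odd
  rw [mul_comp, mul_comp, X_comp, orthPoly_comp_neg_X hα ha]
  have : (C ((-1) ^ m) : ℝ[X]) * C ((-1) ^ m) = 1 := by
    rw [← C_mul, ← mul_pow]; simp
  linear_combination (-X * (orthPoly α a m * orthPoly α a m)) * this

/-- The lower order term `x P_m - P_{m+1}` of the three term recurrence. -/
def recurrenceTail (α a : ℝ) (m : ℕ) : ℝ[X] := X * orthPoly α a m - orthPoly α a (m + 1)

theorem recurrenceTail_degree_lt (α a : ℝ) (m : ℕ) :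
    (recurrenceTail α a m).degree < ((m + 1 : ℕ) : WithBot ℕ) := by
  rw [degree_lt_iff_coeff_zero]
  intro i hi
  obtain ⟨i, rfl⟩ : ∃ j, i = j + 1 := ⟨i - 1, by omega⟩
  rw [recurrenceTail, coeff_sub, coeff_X_mul]
  rcases hi.eq_or_lt with h | h
  · obtain rfl : m = i := by omega
    simp [orthPoly_coeff_self]
  · rw [orthPoly_coeff_of_lt α a (by omega), orthPoly_coeff_of_lt α a (by omega), sub_zero]

theorem degree_X_mul_lt {q : ℝ[X]} {m : ℕ} (hq : q.degree < m) :
    (X * q).degree < ((m + 1 : ℕ) : WithBot ℕ) := by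
  rw [degree_lt_iff_coeff_zero] at hq ⊢
  intro i hi
  obtain ⟨i, rfl⟩ : ∃ j, i = j + 1 := ⟨i - 1, by omega⟩
  rw [coeff_X_mul, hq i (by omega)]

theorem orthPoly_degree_lt (α a : ℝ) {m k : ℕ} (h : k < m) : (orthPoly α a k).degree < m := by
  rw [orthPoly_degree]; exact_mod_cast h

/-- The factor `X` is moved onto `P_k`; the coefficient on the right is nonzero only for `k = m -
1`. -/
theorem momentFunctional_recurrenceTail_mul (ha : a ∈ Ioo (0 : ℝ) 1) {m k : ℕ} (h : k < m) :
    momentFunctional hα a (recurrenceTail α a m * orthPoly α a k) =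
      (X * orthPoly α a k).coeff m * normSq α a m := by
  rw [recurrenceTail, sub_mul, map_sub, momentFunctional_orthPoly_mul_orthPoly hα ha,
    if_neg (by omega), sub_zero, mul_assoc, mul_left_comm,
    momentFunctional_orthPoly_mul hα ha (degree_X_mul_lt (orthPoly_degree_lt α a h))]

theorem momentFunctional_recurrenceTail_mul_self (ha : a ∈ Ioo (0 : ℝ) 1) (m : ℕ) :
    momentFunctional hα a (recurrenceTail α a m * orthPoly α a m) = 0 := by
  rw [recurrenceTail, sub_mul, map_sub, momentFunctional_orthPoly_mul_orthPoly hα ha,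
    if_neg (by omega), sub_zero, mul_assoc, momentFunctional_X_mul_orthPoly_sq hα ha]

-- Working with the tail instead of `β P_{m-1}` lets later identities include `m = 0` without a
-- convention for `P_{-1}`.
include hα in
theorem recurrenceTail_zero (ha : a ∈ Ioo (0 : ℝ) 1) : recurrenceTail α a 0 = 0 := by
  refine eq_zero_of_momentFunctional_mul_orthPoly hα ha (recurrenceTail_degree_lt α a 0) ?_
  intro k hk
  obtain rfl : k = 0 := by omega
  exact momentFunctional_recurrenceTail_mul_self hα ha 0

include hα in
/-- The three term recurrence `x P_{m+1} = P_{m+2} + (h_{m+1} / h_m) P_m`. -/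
theorem recurrenceTail_succ (ha : a ∈ Ioo (0 : ℝ) 1) (m : ℕ) :
    recurrenceTail α a (m + 1) = C (normSq α a (m + 1) / normSq α a m) * orthPoly α a m := by
  rw [← sub_eq_zero]
  refine eq_zero_of_momentFunctional_mul_orthPoly hα ha (m := m + 2) ?_ fun k hk => ?_
  · refine (degree_sub_le _ _).trans_lt (max_lt (recurrenceTail_degree_lt α a (m + 1)) ?_)
    rw [← smul_eq_C_mul]
    exact (degree_smul_le _ _).trans_lt (orthPoly_degree_lt α a (by omega))
  · rw [sub_mul, map_sub, mul_assoc, momentFunctional_C_mul,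
      momentFunctional_orthPoly_mul_orthPoly hα ha]
    rcases Nat.lt_succ_iff_lt_or_eq.1 hk with h | rfl
    · rw [momentFunctional_recurrenceTail_mul hα ha h, coeff_X_mul]
      rcases Nat.lt_succ_iff_lt_or_eq.1 h with h | rfl
      · rw [orthPoly_coeff_of_lt α a h, if_neg (by omega)]; ring
      · rw [orthPoly_coeff_self, if_pos rfl, div_mul_cancel₀ _ (normSq_pos hα ha k).ne']; ring
    · rw [momentFunctional_recurrenceTail_mul_self hα ha, if_neg (by omega)]; ring

include hα in
theorem recurrenceTail_eval_neg (ha : a ∈ Ioo (0 : ℝ) 1) (m : ℕ) (x : ℝ) :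
    (recurrenceTail α a m).eval (-x) = -((-1) ^ m * (recurrenceTail α a m).eval x) := by
  simp only [recurrenceTail, eval_sub, eval_mul, eval_X, orthPoly_eval_neg hα ha]
  ring

/-- The Christoffel-Darboux kernel `K_m(x, y) = ∑_{k < m} P_k(x) P_k(y) / h_k`, as a polynomial in
`x`. -/
def kernel (α a : ℝ) (m : ℕ) (y : ℝ) : ℝ[X] :=
  ∑ k ∈ Finset.range m, C ((orthPoly α a k).eval y / normSq α a k) * orthPoly α a k

theorem kernel_degree_lt (α a : ℝ) (m : ℕ) (y : ℝ) : (kernel α a m y).degree < m := by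
  rw [← mem_degreeLT]
  refine Submodule.sum_mem _ fun k hk => ?_
  rw [mem_degreeLT, ← smul_eq_C_mul]
  exact (degree_smul_le _ _).trans_lt (orthPoly_degree_lt α a (Finset.mem_range.1 hk))

/-- The reproducing property, which turns boundary evaluations at `±a` into polynomials. -/
theorem momentFunctional_kernel_mul_orthPoly (ha : a ∈ Ioo (0 : ℝ) 1) {m k : ℕ} (hk : k < m)
    (y : ℝ) :
    momentFunctional hα a (kernel α a m y * orthPoly α a k) = (orthPoly α a k).eval y := by
  rw [kernel, Finset.sum_mul, map_sum, Finset.sum_eq_single k]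
  · rw [mul_assoc, momentFunctional_C_mul, momentFunctional_orthPoly_mul_orthPoly hα ha,
      if_pos rfl, div_mul_cancel₀ _ (normSq_pos hα ha k).ne']
  · intro j _ hj
    rw [mul_assoc, momentFunctional_C_mul, momentFunctional_orthPoly_mul_orthPoly hα ha,
      if_neg hj, mul_zero]
  · intro h
    exact absurd (Finset.mem_range.2 hk) h

include hα in
/-- The Christoffel-Darboux formula. -/
theorem christoffelDarboux (ha : a ∈ Ioo (0 : ℝ) 1) (m : ℕ) (x y : ℝ) :
    normSq α a m * (x - y) * (kernel α a m y).eval x =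
      (orthPoly α a m).eval x * (recurrenceTail α a m).eval y -
        (recurrenceTail α a m).eval x * (orthPoly α a m).eval y := by
  induction m with
  | zero => simp [kernel, recurrenceTail_zero hα ha]
  | succ m ih =>
    have h0 := (normSq_pos hα ha m).ne'
    have hk : (kernel α a (m + 1) y).eval x = (kernel α a m y).eval x +
        (orthPoly α a m).eval y / normSq α a m * (orthPoly α a m).eval x := by
      simp [kernel, Finset.sum_range_succ]
    have e : ∀ z, (recurrenceTail α a m).eval z =
        z * (orthPoly α a m).eval z - (orthPoly α a (m + 1)).eval z := by
      intro z; simp [recurrenceTail]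
    rw [e, e] at ih
    rw [hk, recurrenceTail_succ hα ha]
    simp only [eval_mul, eval_C]
    field_simp
    linear_combination normSq α a (m + 1) * ih

end

/-! ### The structure relation for the `x`-derivative, and its value at `x = 1`. -/

theorem coeff_X_mul_derivative (p : ℝ[X]) (i : ℕ) :
    (X * derivative p).coeff i = i * p.coeff i := by
  cases i with
  | zero => simp
  | succ i => rw [coeff_X_mul, coeff_derivative]; push_cast; ring

theorem degree_derivative_lt' {p : ℝ[X]} {m : ℕ} (hp : p.degree < m) :
    (derivative p).degree < m :=
  (degree_derivative_le).trans_lt hp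

theorem degree_C_mul_lt {p : ℝ[X]} {m : ℕ} (c : ℝ) (hp : p.degree < m) :
    (C c * p).degree < m := by
  rw [← smul_eq_C_mul]; exact (degree_smul_le _ _).trans_lt hp

theorem degree_sub_lt_of_lt {p q : ℝ[X]} {m : ℕ} (hp : p.degree < m) (hq : q.degree < m) :
    (p - q).degree < m :=
  (degree_sub_le _ _).trans_lt (max_lt hp hq)

theorem degree_add_lt_of_lt {p q : ℝ[X]} {m : ℕ} (hp : p.degree < m) (hq : q.degree < m) :
    (p + q).degree < m :=
  (degree_add_le _ _).trans_lt (max_lt hp hq)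

section

variable {α : ℝ} (hα : 0 < α) {a : ℝ}

/-- Integration by parts moves the derivative onto `P_k`. What then multiplies `P_m` has degree at
most `m`, so only its coefficient at `m` survives: `2(α + 1)` from the weight plus `m - 1` from `X^2
P_k'`. -/
theorem momentFunctional_one_sub_sq_mul_derivative (ha : a ∈ Ioo (0 : ℝ) 1) {m k : ℕ}
    (h : k < m) :
    momentFunctional hα a ((1 - X ^ 2) * derivative (orthPoly α a m) * orthPoly α a k) =
      (2 * α + m + 1) * ((X * orthPoly α a k).coeff m * normSq α a m) -
        (1 - a ^ 2) * (1 - a ^ 2) ^ α * (orthPoly α a m).eval a *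
          ((orthPoly α a k).eval a - (-1) ^ m * (orthPoly α a k).eval (-a)) := by
  set P := orthPoly α a m
  set p := orthPoly α a k with hp
  have hdeg : p.degree < (m : WithBot ℕ) := orthPoly_degree_lt α a h
  have hXd : (X * derivative p).degree < (m : WithBot ℕ) := by
    rw [degree_lt_iff_coeff_zero] at hdeg ⊢
    intro i hi
    rw [coeff_X_mul_derivative, hdeg i hi, mul_zero]
  have e1 : (1 - X ^ 2) * derivative P * p =
      ((1 - X ^ 2) * derivative (P * p) - C (2 * (α + 1)) * X * (P * p)) +
        C (2 * (α + 1)) * (P * (X * p)) - P * (derivative p - X * (X * derivative p)) := by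
    rw [derivative_mul]; ring
  have hlt : (derivative p - X * (X * derivative p)).degree < ((m + 1 : ℕ) : WithBot ℕ) :=
    degree_sub_lt_of_lt
      ((degree_derivative_lt' hdeg).trans (by exact_mod_cast m.lt_succ_self)) (degree_X_mul_lt hXd)
  have hc : (derivative p - X * (X * derivative p)).coeff m =
      -(((m : ℝ) - 1) * (X * p).coeff m) := by
    obtain ⟨m, rfl⟩ : ∃ j, m = j + 1 := ⟨m - 1, by omega⟩
    rw [coeff_sub, coeff_X_mul, coeff_X_mul, coeff_X_mul_derivative, coeff_derivative,
      hp, orthPoly_coeff_of_lt α a (by omega)]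
    push_cast; ring
  rw [e1, map_sub, map_add, momentFunctional_integration_by_parts hα ha, momentFunctional_C_mul,
    momentFunctional_orthPoly_mul hα ha (degree_X_mul_lt hdeg),
    momentFunctional_orthPoly_mul hα ha hlt, hc, eval_mul, eval_mul, orthPoly_eval_neg hα ha m]
  ring

theorem momentFunctional_one_sub_sq_mul_derivative_self (ha : a ∈ Ioo (0 : ℝ) 1) (m : ℕ) :
    momentFunctional hα a ((1 - X ^ 2) * derivative (orthPoly α a m) * orthPoly α a m) = 0 := by
  set P := orthPoly α a m
  have e1 : C 2 * ((1 - X ^ 2) * derivative P * P) =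
      ((1 - X ^ 2) * derivative (P * P) - C (2 * (α + 1)) * X * (P * P)) +
        C (2 * (α + 1)) * (X * (P * P)) := by
    rw [derivative_mul, show (C 2 : ℝ[X]) = 2 from rfl]; ring
  have e2 := congrArg (momentFunctional hα a) e1
  rw [map_add, momentFunctional_integration_by_parts hα ha, momentFunctional_C_mul,
    momentFunctional_C_mul, momentFunctional_X_mul_orthPoly_sq hα ha, eval_mul, eval_mul,
    orthPoly_eval_neg hα ha m] at e2
  have e3 : ((-1 : ℝ) ^ m) * (-1) ^ m = 1 := by rw [← mul_pow]; simp
  linear_combination (1 / 2) * e2 +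
    (1 / 2 * (1 - a ^ 2) * (1 - a ^ 2) ^ α * P.eval a ^ 2) * e3

include hα in
/-- The differential-difference relation for the derivative of `P_m`. -/
theorem orthPoly_structure_relation (ha : a ∈ Ioo (0 : ℝ) 1) (m : ℕ) :
    (1 - X ^ 2) * derivative (orthPoly α a m) + C (m : ℝ) * orthPoly α a (m + 1) -
      C (2 * α + m + 1) * recurrenceTail α a m +
      C ((1 - a ^ 2) * (1 - a ^ 2) ^ α * (orthPoly α a m).eval a) *
        (kernel α a m a - C ((-1) ^ m) * kernel α a m (-a)) = 0 := by
  have hm : (m : WithBot ℕ) < ((m + 1 : ℕ) : WithBot ℕ) := by exact_mod_cast m.lt_succ_self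
  refine eq_zero_of_momentFunctional_mul_orthPoly hα ha (m := m + 1) ?_ fun k hk => ?_
  -- The terms of degree `m + 1` in `-X^2 P_m'` and `m P_{m+1}` cancel; this form makes the
  -- cancellation visible.
  · have e : (1 - X ^ 2) * derivative (orthPoly α a m) + C (m : ℝ) * orthPoly α a (m + 1) =
        derivative (orthPoly α a m) -
          X * (X * derivative (orthPoly α a m) - C (m : ℝ) * orthPoly α a m) -
          C (m : ℝ) * recurrenceTail α a m := by
      rw [recurrenceTail]; ring
    have hP := orthPoly_degree_lt α a m.lt_succ_self
    have hT := recurrenceTail_degree_lt α a m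
    have h1 : (X * derivative (orthPoly α a m) - C (m : ℝ) * orthPoly α a m).degree < (m : WithBot ℕ) := by
      rw [degree_lt_iff_coeff_zero]
      intro i hi
      rw [coeff_sub, coeff_X_mul_derivative, coeff_C_mul]
      rcases hi.eq_or_lt with rfl | hi
      · ring
      · rw [orthPoly_coeff_of_lt α a hi]; ring
    have hK := fun y => (kernel_degree_lt α a m y).trans hm
    rw [e]
    exact degree_add_lt_of_lt (degree_sub_lt_of_lt (degree_sub_lt_of_lt (degree_sub_lt_of_lt
      (degree_derivative_lt' hP) (degree_X_mul_lt h1)) (degree_C_mul_lt _ hT))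
      (degree_C_mul_lt _ hT))
      (degree_C_mul_lt _ (degree_sub_lt_of_lt (hK a) (degree_C_mul_lt _ (hK (-a)))))
  · rw [add_mul, sub_mul, add_mul, map_add, map_sub, map_add]
    simp only [mul_assoc (C _ : ℝ[X]), momentFunctional_C_mul]
    rw [sub_mul (kernel α a m a), map_sub, mul_assoc (C _ : ℝ[X]), momentFunctional_C_mul,
      momentFunctional_orthPoly_mul_orthPoly hα ha, if_neg (by omega)]
    rcases Nat.lt_succ_iff_lt_or_eq.1 hk with h | rfl
    · rw [momentFunctional_one_sub_sq_mul_derivative hα ha h,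
        momentFunctional_recurrenceTail_mul hα ha h,
        momentFunctional_kernel_mul_orthPoly hα ha h,
        momentFunctional_kernel_mul_orthPoly hα ha h]
      ring
    -- For `k = m` the kernels drop out, having degree less than `m`.
    · have hK : ∀ y, momentFunctional hα a (kernel α a k y * orthPoly α a k) = 0 := fun y => by
        rw [mul_comm, momentFunctional_orthPoly_mul_of_degree_lt hα ha (kernel_degree_lt α a k y)]
      rw [momentFunctional_one_sub_sq_mul_derivative_self hα ha,
        momentFunctional_recurrenceTail_mul_self hα ha, hK, hK]
      ring

-- At `x = 1` the derivative term disappears. The factors `1 ∓ a` from Christoffel-Darboux are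
-- absorbed by `1 - a^2`.
include hα in
theorem orthPoly_relation_at_one (ha : a ∈ Ioo (0 : ℝ) 1) (m : ℕ) :
    normSq α a m * (m * (orthPoly α a (m + 1)).eval 1 -
      (2 * α + m + 1) * (recurrenceTail α a m).eval 1) +
      2 * (1 - a ^ 2) ^ α * (orthPoly α a m).eval a *
        ((orthPoly α a m).eval 1 * (recurrenceTail α a m).eval a -
          a * (recurrenceTail α a m).eval 1 * (orthPoly α a m).eval a) = 0 := by
  have h := congrArg (eval 1) (orthPoly_structure_relation hα ha m)
  simp only [eval_add, eval_sub, eval_mul, eval_C, eval_pow, eval_X, eval_one, eval_zero] at h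
  have h1 := christoffelDarboux hα ha m 1 a
  have h2 := christoffelDarboux hα ha m 1 (-a)
  rw [orthPoly_eval_neg hα ha, recurrenceTail_eval_neg hα ha] at h2
  have e3 : ((-1 : ℝ) ^ m) * (-1) ^ m = 1 := by rw [← mul_pow]; simp
  set W := (1 - a ^ 2) ^ α
  set p := (orthPoly α a m).eval a
  set K1 := (kernel α a m a).eval 1
  set K2 := (kernel α a m (-a)).eval 1
  set P1 := (orthPoly α a m).eval 1
  set Q1 := (recurrenceTail α a m).eval 1
  set q := (recurrenceTail α a m).eval a
  linear_combination normSq α a m * h - W * p * (1 + a) * h1 + W * p * (1 - a) * (-1) ^ m * h2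
    - W * p * (1 - a) * (P1 * q + Q1 * p) * e3

end

/-! ### Differentiation with respect to the endpoint `a`. -/

/-- The family `p` of polynomials, of bounded degree, is differentiable at `a` coefficientwise, with
derivative `p'`. -/
def HasPolyDerivAt (p : ℝ → ℝ[X]) (p' : ℝ[X]) (a : ℝ) : Prop :=
  (∃ M : ℕ, ∀ b, (p b).degree < M) ∧
    ∀ i, HasDerivAt (fun b => (p b).coeff i) (p'.coeff i) a

namespace HasPolyDerivAt

variable {p q : ℝ → ℝ[X]} {p' q' : ℝ[X]} {a : ℝ}

theorem const (p : ℝ[X]) (a : ℝ) : HasPolyDerivAt (fun _ => p) 0 a :=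
  ⟨⟨p.natDegree + 1, fun _ => degree_le_natDegree.trans_lt (by exact_mod_cast Nat.lt_succ_self _)⟩,
    fun i => by simpa using hasDerivAt_const a (p.coeff i)⟩

/-- Coefficients from degree `M` on do not depend on `b`. Taking `c = X ^ n` shows that the
`a`-derivative of the monic `P_n` has degree below `n`. -/
theorem degree_lt (h : HasPolyDerivAt p p' a) {c : ℝ[X]} {M : ℕ}
    (hM : ∀ b, (p b - c).degree < M) : p'.degree < M := by
  rw [degree_lt_iff_coeff_zero]
  intro i hi
  have h1 : (fun b => (p b).coeff i) = fun _ => c.coeff i := by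
    ext b
    have := (degree_lt_iff_coeff_zero _ _).1 (hM b) i hi
    rw [coeff_sub] at this
    linarith
  have h2 := h.2 i
  rw [h1] at h2
  exact h2.unique (hasDerivAt_const a _)

theorem sub (hp : HasPolyDerivAt p p' a) (hq : HasPolyDerivAt q q' a) :
    HasPolyDerivAt (fun b => p b - q b) (p' - q') a := by
  obtain ⟨⟨M, hM⟩, hp⟩ := hp
  obtain ⟨⟨N, hN⟩, hq⟩ := hq
  refine ⟨⟨max M N, fun b => degree_sub_lt_of_lt ((hM b).trans_le ?_) ((hN b).trans_le ?_)⟩,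
    fun i => ?_⟩
  · exact_mod_cast le_max_left M N
  · exact_mod_cast le_max_right M N
  · simp only [coeff_sub]
    exact (hp i).sub (hq i)

theorem mul (hp : HasPolyDerivAt p p' a) (hq : HasPolyDerivAt q q' a) :
    HasPolyDerivAt (fun b => p b * q b) (p' * q a + p a * q') a := by
  obtain ⟨⟨M, hM⟩, hp⟩ := hp
  obtain ⟨⟨N, hN⟩, hq⟩ := hq
  refine ⟨⟨M + N, fun b => ?_⟩, fun i => ?_⟩
  · rw [degree_lt_iff_coeff_zero]
    intro i hi
    rw [coeff_mul]
    refine Finset.sum_eq_zero fun x hx => ?_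
    rw [Finset.HasAntidiagonal.mem_antidiagonal] at hx
    rcases lt_or_ge x.1 M with h | h
    · rw [(degree_lt_iff_coeff_zero _ _).1 (hN b) x.2 (by omega), mul_zero]
    · rw [(degree_lt_iff_coeff_zero _ _).1 (hM b) x.1 h, zero_mul]
  · simp only [coeff_add, coeff_mul, ← Finset.sum_add_distrib]
    exact HasDerivAt.fun_sum fun x _ => (hp x.1).mul (hq x.2)

theorem C_mul {c : ℝ → ℝ} {c' : ℝ} (hc : HasDerivAt c c' a) (hp : HasPolyDerivAt p p' a) :
    HasPolyDerivAt (fun b => C (c b) * p b) (C c' * p a + C (c a) * p') a := by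
  obtain ⟨⟨M, hM⟩, hp⟩ := hp
  refine ⟨⟨M, fun b => degree_C_mul_lt _ (hM b)⟩, fun i => ?_⟩
  simp only [coeff_add, coeff_C_mul]
  exact hc.mul (hp i)

theorem sum {ι : Type*} (t : Finset ι) {p : ι → ℝ → ℝ[X]} {p' : ι → ℝ[X]}
    (hp : ∀ k ∈ t, HasPolyDerivAt (p k) (p' k) a) :
    HasPolyDerivAt (fun b => ∑ k ∈ t, p k b) (∑ k ∈ t, p' k) a := by
  classical
  induction t using Finset.induction_on with
  | empty => simpa using const 0 a
  | insert k t hk ih =>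
    have h1 := hp k (Finset.mem_insert_self k t)
    have h2 := ih fun j hj => hp j (Finset.mem_insert_of_mem hj)
    -- Addition is written as subtraction of a negative.
    have h3 := h1.sub ((const 0 a).sub h2)
    simpa [Finset.sum_insert hk] using h3

theorem eq_sum (h : HasPolyDerivAt p p' a) :
    ∃ M, (∀ b, p b = ∑ i ∈ Finset.range M, C ((p b).coeff i) * X ^ i) ∧
      p' = ∑ i ∈ Finset.range M, C (p'.coeff i) * X ^ i := by
  obtain ⟨M, hM⟩ := h.1
  have h1 : p'.degree < M := h.degree_lt (c := 0) (by simpa using hM)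
  have h2 : ∀ q : ℝ[X], q.degree < M → q = ∑ i ∈ Finset.range M, C (q.coeff i) * X ^ i := by
    intro q hq
    ext j
    simp only [finsetSum_coeff, coeff_C_mul, coeff_X_pow, mul_ite, mul_one, mul_zero,
      Finset.sum_ite_eq, Finset.mem_range]
    split_ifs with hj
    · rfl
    · exact (degree_lt_iff_coeff_zero _ _).1 hq j (not_lt.1 hj)
  exact ⟨M, fun b => h2 _ (hM b), h2 _ h1⟩

theorem hasDerivAt_momentFunctional {α : ℝ} (hα : 0 < α) (ha : a ∈ Ioo (0 : ℝ) 1)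
    (h : HasPolyDerivAt p p' a) :
    HasDerivAt (fun b => momentFunctional hα b (p b))
      (momentFunctional hα a p' - ((p a).eval a + (p a).eval (-a)) * (1 - a ^ 2) ^ α) a := by
  obtain ⟨M, h1, h2⟩ := h.eq_sum
  have h3 : (fun b => momentFunctional hα b (p b)) = fun b =>
      ∑ i ∈ Finset.range M, (p b).coeff i * momentFunctional hα b (X ^ i) := by
    ext b
    conv_lhs => rw [h1 b]
    simp only [map_sum, momentFunctional_C_mul]
  rw [h3]
  have h4 := HasDerivAt.fun_sum fun i (_ : i ∈ Finset.range M) =>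
    (h.2 i).mul (JacobiGap.hasDerivAt_momentFunctional hα ha (X ^ i))
  refine h4.congr_deriv ?_
  conv_rhs => rw [h2, h1 a]
  simp only [map_sum, momentFunctional_C_mul, eval_finsetSum, eval_mul, eval_C, eval_pow, eval_X]
  rw [← Finset.sum_add_distrib, Finset.sum_mul, ← Finset.sum_sub_distrib]
  exact Finset.sum_congr rfl fun i _ => by ring

theorem hasDerivAt_eval_self (h : HasPolyDerivAt p p' a) :
    HasDerivAt (fun b => (p b).eval b) (p'.eval a + (derivative (p a)).eval a) a := by
  obtain ⟨M, h1, h2⟩ := h.eq_sum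
  have h3 : (fun b => (p b).eval b) = fun b =>
      ∑ i ∈ Finset.range M, (p b).coeff i * b ^ i := by
    ext b
    conv_lhs => rw [h1 b]
    simp [eval_finsetSum]
  rw [h3]
  have h4 := HasDerivAt.fun_sum fun i (_ : i ∈ Finset.range M) =>
    (h.2 i).mul (hasDerivAt_pow i a)
  refine h4.congr_deriv ?_
  conv_rhs => rw [h2, h1 a]
  simp only [derivative_sum, derivative_C_mul_X_pow, eval_finsetSum, eval_mul, eval_C, eval_pow,
    eval_X]
  rw [← Finset.sum_add_distrib]
  exact Finset.sum_congr rfl fun i _ => by ring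

end HasPolyDerivAt

section

variable {α : ℝ} (hα : 0 < α) {a : ℝ}

-- Existence only, by induction along Gram-Schmidt; the value is identified afterwards by
-- differentiating orthogonality.
include hα in
theorem exists_hasPolyDerivAt_orthPoly (ha : a ∈ Ioo (0 : ℝ) 1) (n : ℕ) :
    ∃ p', HasPolyDerivAt (fun b => orthPoly α b n) p' a := by
  induction n using Nat.strong_induction_on with
  | _ n ih =>
    choose! d hd using ih
    have hpair : ∀ (p q : ℝ → ℝ[X]) (p' q' : ℝ[X]), HasPolyDerivAt p p' a →
        HasPolyDerivAt q q' a → ∃ c, HasDerivAt (fun b => pairing α b (p b) (q b)) c a := by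
      intro p q p' q' hp hq
      simp only [pairing_eq_momentFunctional hα]
      exact ⟨_, (hp.mul hq).hasDerivAt_momentFunctional hα ha⟩
    have hcoef : ∀ k : Fin n, ∃ c, HasDerivAt
        (fun b => pairing α b (X ^ n) (orthPoly α b k) / normSq α b k) c a := by
      intro k
      obtain ⟨c1, h1⟩ := hpair _ _ _ _ (HasPolyDerivAt.const (X ^ n) a) (hd k k.2)
      obtain ⟨c2, h2⟩ := hpair _ _ _ _ (hd k k.2) (hd k k.2)
      exact ⟨_, h1.div h2 (normSq_pos hα ha k).ne'⟩
    choose c hc using hcoef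
    have hs := (HasPolyDerivAt.const (X ^ n) a).sub
      (HasPolyDerivAt.sum Finset.univ fun (k : Fin n) _ =>
        HasPolyDerivAt.C_mul (hc k) (hd k k.2))
    simp only [← orthPoly_eq] at hs
    exact ⟨_, hs⟩

include hα in
/-- The derivative of `P_n(x, a)` with respect to `a`. -/
theorem hasPolyDerivAt_orthPoly (ha : a ∈ Ioo (0 : ℝ) 1) (n : ℕ) :
    HasPolyDerivAt (fun b => orthPoly α b n)
      (C ((1 - a ^ 2) ^ α * (orthPoly α a n).eval a) *
        (kernel α a n a + C ((-1) ^ n) * kernel α a n (-a))) a := by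
  obtain ⟨p', hp'⟩ := exists_hasPolyDerivAt_orthPoly hα ha n
  have hdeg : ∀ m (q' : ℝ[X]), HasPolyDerivAt (fun b => orthPoly α b m) q' a → q'.degree < m := by
    intro m q' hq'
    refine hq'.degree_lt (c := X ^ m) fun b => ?_
    rw [degree_lt_iff_coeff_zero]
    intro i hi
    rw [coeff_sub, coeff_X_pow]
    rcases hi.eq_or_lt with rfl | hi
    · simp [orthPoly_coeff_self]
    · rw [orthPoly_coeff_of_lt α b hi, if_neg (by omega), sub_zero]
  convert hp' using 1
  symm
  rw [← sub_eq_zero]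
  refine eq_zero_of_momentFunctional_mul_orthPoly hα ha (m := n) ?_ fun k hk => ?_
  · exact degree_sub_lt_of_lt (hdeg n p' hp') (degree_C_mul_lt _ (degree_add_lt_of_lt
      (kernel_degree_lt α a n a) (degree_C_mul_lt _ (kernel_degree_lt α a n (-a)))))
  · obtain ⟨q', hq'⟩ := exists_hasPolyDerivAt_orthPoly hα ha k
    -- Differentiate `0 = ∫ P_n P_k w` in `a`. The term containing the derivative of `P_k` vanishes
    -- by degree, so the derivative of `P_n` is tested against `P_k` by boundary values alone.
    have h1 := (hp'.mul hq').hasDerivAt_momentFunctional hα ha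
    have h2 : (fun b => momentFunctional hα b (orthPoly α b n * orthPoly α b k)) =ᶠ[nhds a]
        fun _ => 0 := by
      filter_upwards [isOpen_Ioo.mem_nhds ha] with b hb
      rw [momentFunctional_orthPoly_mul_orthPoly hα hb, if_neg (by omega)]
    have h3 := h1.unique ((hasDerivAt_const a (0 : ℝ)).congr_of_eventuallyEq h2)
    have h4 := momentFunctional_orthPoly_mul_of_degree_lt hα ha (m := n)
      ((hdeg k q' hq').trans (by exact_mod_cast hk))
    rw [map_add, h4, eval_mul, eval_mul, orthPoly_eval_neg hα ha n] at h3
    rw [sub_mul, map_sub, mul_assoc, momentFunctional_C_mul, add_mul, map_add,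
      mul_assoc (C ((-1) ^ n) : ℝ[X]),
      momentFunctional_C_mul, momentFunctional_kernel_mul_orthPoly hα ha hk,
      momentFunctional_kernel_mul_orthPoly hα ha hk]
    linear_combination h3

-- The derivative of `P_n` has degree below `n` and is orthogonal to `P_n`; only the two equal
-- boundary terms remain.
include hα in
theorem hasDerivAt_normSq (ha : a ∈ Ioo (0 : ℝ) 1) (n : ℕ) :
    HasDerivAt (fun b => normSq α b n)
      (-(2 * (1 - a ^ 2) ^ α * (orthPoly α a n).eval a ^ 2)) a := by
  have hp := hasPolyDerivAt_orthPoly hα ha n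
  have h1 := (hp.mul hp).hasDerivAt_momentFunctional hα ha
  simp only [normSq, pairing_eq_momentFunctional hα]
  refine h1.congr_deriv ?_
  have hd := degree_C_mul_lt ((1 - a ^ 2) ^ α * (orthPoly α a n).eval a) (degree_add_lt_of_lt
      (kernel_degree_lt α a n a) (degree_C_mul_lt ((-1) ^ n) (kernel_degree_lt α a n (-a))))
  have h2 := momentFunctional_orthPoly_mul_of_degree_lt hα ha hd
  have e3 : ((-1 : ℝ) ^ n) * (-1) ^ n = 1 := by rw [← mul_pow]; simp
  rw [map_add, mul_comm _ (orthPoly α a n), h2, eval_mul, eval_mul, orthPoly_eval_neg hα ha n]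
  linear_combination (-(1 - a ^ 2) ^ α * (orthPoly α a n).eval a ^ 2) * e3

include hα in
/-- The derivative of `P_n(a, a)`, multiplied by `1 - a ^ 2`. -/
theorem hasDerivAt_orthPoly_eval_self (ha : a ∈ Ioo (0 : ℝ) 1) (n : ℕ) :
    HasDerivAt (fun b => (orthPoly α b n).eval b)
      ((-(n * (orthPoly α a (n + 1)).eval a) + (2 * α + n + 1) * (recurrenceTail α a n).eval a -
        2 * (1 - a ^ 2) * (1 - a ^ 2) ^ α * (orthPoly α a n).eval a ^ 2 *
          (recurrenceTail α a n).eval a / (a * normSq α a n)) / (1 - a ^ 2)) a := by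
  have ha0 : a ≠ 0 := ha.1.ne'
  have hw : 1 - a ^ 2 ≠ 0 := by nlinarith [ha.1, ha.2]
  have hn := (normSq_pos hα ha n).ne'
  refine (hasPolyDerivAt_orthPoly hα ha n).hasDerivAt_eval_self.congr_deriv ?_
  -- The total derivative adds the `a`-derivative and the `x`-derivative. Their `K_n(a, a)` terms
  -- cancel and the `K_n(a, -a)` terms double, so no confluent Christoffel-Darboux formula is
  -- needed.
  have h := congrArg (eval a) (orthPoly_structure_relation hα ha n)
  simp only [eval_add, eval_sub, eval_mul, eval_C, eval_pow, eval_X, eval_one, eval_zero] at h ⊢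
  have h2 := christoffelDarboux hα ha n a (-a)
  rw [orthPoly_eval_neg hα ha, recurrenceTail_eval_neg hα ha] at h2
  have e3 : ((-1 : ℝ) ^ n) * (-1) ^ n = 1 := by rw [← mul_pow]; simp
  rw [eq_div_iff hw]
  set W := (1 - a ^ 2) ^ α
  set p := (orthPoly α a n).eval a
  set q := (recurrenceTail α a n).eval a
  set K := (kernel α a n (-a)).eval a
  have h5 : (-1) ^ n * K = - (p * q) / (a * normSq α a n) := by
    rw [eq_div_iff (mul_ne_zero ha0 hn)]
    linear_combination (-1) ^ n / 2 * h2 - p * q * e3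
  linear_combination h + 2 * (1 - a ^ 2) * W * p * h5

end

/-! ### The closed system for `r`, the residues and the recurrence coefficient. -/

/-- `2 P_{m+1}(a, a) ^ 2 (1 - a ^ 2) ^ α / h_m(a)`. -/
def upperResidue (α : ℝ) (m : ℕ) (a : ℝ) : ℝ :=
  2 * (orthPoly α a (m + 1)).eval a ^ 2 * (1 - a ^ 2) ^ α / normSq α a m

/-- `2 P_m(a, a) ^ 2 (1 - a ^ 2) ^ α / h_m(a)`. -/
def lowerResidue (α : ℝ) (m : ℕ) (a : ℝ) : ℝ :=
  2 * (orthPoly α a m).eval a ^ 2 * (1 - a ^ 2) ^ α / normSq α a m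

/-- The recurrence coefficient `h_{m+1} / h_m`. -/
def recurrenceCoeff (α : ℝ) (m : ℕ) (a : ℝ) : ℝ := normSq α a (m + 1) / normSq α a m

theorem r_succ (α : ℝ) (m : ℕ) (a : ℝ) :
    r α (m + 1) a = 2 * (orthPoly α a (m + 1)).eval a * (orthPoly α a m).eval a *
      (1 - a ^ 2) ^ α / normSq α a m := rfl

theorem upperResidue_mul_lowerResidue (α : ℝ) (m : ℕ) (a : ℝ) :
    upperResidue α m a * lowerResidue α m a = r α (m + 1) a ^ 2 := by
  rw [upperResidue, lowerResidue, r_succ]; ring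

theorem one_sub_sq_pos {a : ℝ} (ha : a ∈ Ioo (0 : ℝ) 1) : 0 < 1 - a ^ 2 := by
  nlinarith [ha.1, ha.2]

section

variable {α : ℝ} (hα : 0 < α) {a : ℝ}

include hα

theorem recurrenceTail_succ_eval (ha : a ∈ Ioo (0 : ℝ) 1) (m : ℕ) (x : ℝ) :
    (recurrenceTail α a (m + 1)).eval x = recurrenceCoeff α m a * (orthPoly α a m).eval x := by
  rw [recurrenceTail_succ hα ha, eval_mul, eval_C, recurrenceCoeff]

theorem recurrenceCoeff_pos (ha : a ∈ Ioo (0 : ℝ) 1) (m : ℕ) : 0 < recurrenceCoeff α m a :=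
  div_pos (normSq_pos hα ha _) (normSq_pos hα ha _)

theorem lowerResidue_nonneg (ha : a ∈ Ioo (0 : ℝ) 1) (m : ℕ) : 0 ≤ lowerResidue α m a := by
  have h1 := normSq_pos hα ha m
  have h2 := Real.rpow_pos_of_pos (one_sub_sq_pos ha) α
  unfold lowerResidue
  positivity

theorem relation_at_one_lower (ha : a ∈ Ioo (0 : ℝ) 1) (m : ℕ) :
    (2 * α + 2 * m + 1 + a * lowerResidue α m a) * (orthPoly α a (m + 1)).eval 1 =
      (2 * α + m + 1 + r α (m + 1) a) * (orthPoly α a m).eval 1 := by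
  have h := orthPoly_relation_at_one hα ha m
  have hn := (normSq_pos hα ha m).ne'
  have e : ∀ z, (recurrenceTail α a m).eval z =
      z * (orthPoly α a m).eval z - (orthPoly α a (m + 1)).eval z := by
    intro z; simp [recurrenceTail]
  rw [e, e] at h
  rw [lowerResidue, r_succ]
  field_simp
  linear_combination h

/-- The relation at `x = 1` for index `m + 1`, with `P_{m+2}` eliminated by the recurrence. -/
theorem relation_at_one_upper (ha : a ∈ Ioo (0 : ℝ) 1) (m : ℕ) :
    (m + 1 + r α (m + 1) a) * (orthPoly α a (m + 1)).eval 1 =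
      ((2 * α + 2 * m + 3) * recurrenceCoeff α m a + a * upperResidue α m a) *
        (orthPoly α a m).eval 1 := by
  have h := orthPoly_relation_at_one hα ha (m + 1)
  have hn := (normSq_pos hα ha m).ne'
  have hn' := (normSq_pos hα ha (m + 1)).ne'
  have e : (orthPoly α a (m + 1 + 1)).eval 1 =
      (orthPoly α a (m + 1)).eval 1 - recurrenceCoeff α m a * (orthPoly α a m).eval 1 := by
    rw [← recurrenceTail_succ_eval hα ha]; simp [recurrenceTail]
  rw [recurrenceTail_succ_eval hα ha, recurrenceTail_succ_eval hα ha, e] at h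
  rw [upperResidue, r_succ]
  simp only [recurrenceCoeff] at h ⊢
  field_simp at h ⊢
  push_cast at h
  refine mul_left_cancel₀ hn' ?_
  linear_combination h

/-- A zero of `P_{m+1}` at `1` would pass up to `P_{m+2}` by `relation_at_one_lower`, whose left
coefficient is positive, and then down to `P_m` by the recurrence, contradicting the induction
hypothesis. -/
theorem orthPoly_eval_one_ne_zero (ha : a ∈ Ioo (0 : ℝ) 1) (m : ℕ) :
    (orthPoly α a m).eval 1 ≠ 0 := by
  have hstep : ∀ m, (orthPoly α a m).eval 1 = 0 → (orthPoly α a (m + 1)).eval 1 = 0 := by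
    intro m hm
    have h := relation_at_one_lower hα ha m
    rw [hm, mul_zero] at h
    have hpos : 0 < 2 * α + 2 * m + 1 + a * lowerResidue α m a := by
      have := mul_nonneg ha.1.le (lowerResidue_nonneg hα ha m)
      positivity
    exact (mul_eq_zero.1 h).resolve_left hpos.ne'
  induction m with
  | zero => simp [orthPoly_zero]
  | succ m ih =>
    intro h0
    have h1 := hstep _ h0
    have h2 := recurrenceTail_succ_eval hα ha m 1
    rw [recurrenceTail, eval_sub, eval_mul, eval_X, h0, h1] at h2
    rcases mul_eq_zero.1 (h2.symm.trans (by ring)) with h | h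
    · exact (recurrenceCoeff_pos hα ha m).ne' h
    · exact ih h

/-- The algebraic relation between `r_{m+1}`, the residues and the recurrence coefficient. -/
theorem residue_relation (ha : a ∈ Ioo (0 : ℝ) 1) (m : ℕ) :
    (m + 1 + r α (m + 1) a) * (2 * α + m + 1 + r α (m + 1) a) =
      ((2 * α + 2 * m + 3) * recurrenceCoeff α m a + a * upperResidue α m a) *
        (2 * α + 2 * m + 1 + a * lowerResidue α m a) := by
  have h1 := relation_at_one_lower hα ha m
  have h2 := relation_at_one_upper hα ha m
  -- Two homogeneous linear relations between `P_{m+1}(1)` and `P_m(1)`, both nonzero, force the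
  -- determinant to vanish.
  refine mul_right_cancel₀ (mul_ne_zero (orthPoly_eval_one_ne_zero hα ha (m + 1))
    (orthPoly_eval_one_ne_zero hα ha m)) ?_
  linear_combination (2 * α + m + 1 + r α (m + 1) a) * (orthPoly α a m).eval 1 * h2 -
    ((2 * α + 2 * m + 3) * recurrenceCoeff α m a + a * upperResidue α m a) *
      (orthPoly α a m).eval 1 * h1

theorem hasDerivAt_upper_eval (ha : a ∈ Ioo (0 : ℝ) 1) (m : ℕ) :
    HasDerivAt (fun b => (orthPoly α b (m + 1)).eval b)
      (-((m + 1) * a * (orthPoly α a (m + 1)).eval a) / (1 - a ^ 2) +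
        (2 * α + 2 * m + 3) * recurrenceCoeff α m a * (orthPoly α a m).eval a / (1 - a ^ 2) -
        r α (m + 1) a * (orthPoly α a (m + 1)).eval a / a) a := by
  refine (hasDerivAt_orthPoly_eval_self hα ha (m + 1)).congr_deriv ?_
  have e : (orthPoly α a (m + 1 + 1)).eval a =
      a * (orthPoly α a (m + 1)).eval a - recurrenceCoeff α m a * (orthPoly α a m).eval a := by
    rw [← recurrenceTail_succ_eval hα ha]; simp [recurrenceTail]
  rw [recurrenceTail_succ_eval hα ha, e, r_succ, recurrenceCoeff]
  have hn := (normSq_pos hα ha m).ne'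
  have hn' := (normSq_pos hα ha (m + 1)).ne'
  have ha0 : a ≠ 0 := ha.1.ne'
  have hw := (one_sub_sq_pos ha).ne'
  push_cast
  field_simp
  ring

theorem hasDerivAt_lower_eval (ha : a ∈ Ioo (0 : ℝ) 1) (m : ℕ) :
    HasDerivAt (fun b => (orthPoly α b m).eval b)
      (-((2 * α + 2 * m + 1) * (orthPoly α a (m + 1)).eval a) / (1 - a ^ 2) +
        (2 * α + m + 1) * a * (orthPoly α a m).eval a / (1 - a ^ 2) -
        (lowerResidue α m a - r α (m + 1) a / a) * (orthPoly α a m).eval a) a := by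
  refine (hasDerivAt_orthPoly_eval_self hα ha m).congr_deriv ?_
  have e : (recurrenceTail α a m).eval a =
      a * (orthPoly α a m).eval a - (orthPoly α a (m + 1)).eval a := by
    simp [recurrenceTail]
  rw [e, r_succ, lowerResidue]
  have hn := (normSq_pos hα ha m).ne'
  have ha0 : a ≠ 0 := ha.1.ne'
  have hw := (one_sub_sq_pos ha).ne'
  field_simp
  ring

theorem hasDerivAt_rpow_div_normSq (ha : a ∈ Ioo (0 : ℝ) 1) (m : ℕ) :
    HasDerivAt (fun b => (1 - b ^ 2) ^ α / normSq α b m)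
      ((-(2 * α * a) / (1 - a ^ 2) + lowerResidue α m a) *
        ((1 - a ^ 2) ^ α / normSq α a m)) a := by
  have hn := (normSq_pos hα ha m).ne'
  have hw := (one_sub_sq_pos ha).ne'
  have h1 : HasDerivAt (fun x : ℝ => 1 - x ^ 2) (-(2 * a)) a := by
    simpa using ((hasDerivAt_pow 2 a).const_sub 1)
  refine ((h1.rpow_const (p := α) (Or.inl hw)).div (hasDerivAt_normSq hα ha m) hn).congr_deriv ?_
  rw [Real.rpow_sub_one hw, lowerResidue]
  field_simp
  ring

/-- All terms proportional to `r` cancel: the logarithmic derivatives of the three factors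
contribute opposite multiples of `a / (1 - a^2)`, `r / a` and `R`. Only the cross terms are left. -/
theorem hasDerivAt_r (ha : a ∈ Ioo (0 : ℝ) 1) (m : ℕ) :
    HasDerivAt (r α (m + 1))
      (((2 * α + 2 * m + 3) * recurrenceCoeff α m a * lowerResidue α m a -
        (2 * α + 2 * m + 1) * upperResidue α m a) / (1 - a ^ 2)) a := by
  have hn := (normSq_pos hα ha m).ne'
  have ha0 : a ≠ 0 := ha.1.ne'
  have hw := (one_sub_sq_pos ha).ne'
  have h := (((hasDerivAt_upper_eval hα ha m).mul (hasDerivAt_lower_eval hα ha m)).mul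
    (hasDerivAt_rpow_div_normSq hα ha m)).const_mul 2
  refine (h.congr_of_eventuallyEq (Filter.Eventually.of_forall fun b => ?_)).congr_deriv ?_
  · simp only [Pi.mul_apply, r_succ]; ring
  · simp only [Pi.mul_apply, upperResidue]
    rw [lowerResidue, r_succ]
    field_simp
    ring

theorem hasDerivAt_upperResidue (ha : a ∈ Ioo (0 : ℝ) 1) (m : ℕ) :
    HasDerivAt (upperResidue α m)
      (upperResidue α m a * (-(2 * (m + 1 + α) * a) / (1 - a ^ 2) - 2 * r α (m + 1) a / a +
          lowerResidue α m a) +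
        2 * (2 * α + 2 * m + 3) * recurrenceCoeff α m a * r α (m + 1) a / (1 - a ^ 2)) a := by
  have hn := (normSq_pos hα ha m).ne'
  have ha0 : a ≠ 0 := ha.1.ne'
  have hw := (one_sub_sq_pos ha).ne'
  have hu := hasDerivAt_upper_eval hα ha m
  have h := ((hu.mul hu).mul (hasDerivAt_rpow_div_normSq hα ha m)).const_mul 2
  refine (h.congr_of_eventuallyEq (Filter.Eventually.of_forall fun b => ?_)).congr_deriv ?_
  · simp only [Pi.mul_apply, upperResidue]; ring
  · simp only [Pi.mul_apply, upperResidue]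
    rw [lowerResidue, r_succ]
    field_simp
    ring

theorem hasDerivAt_lowerResidue (ha : a ∈ Ioo (0 : ℝ) 1) (m : ℕ) :
    HasDerivAt (lowerResidue α m)
      (lowerResidue α m a * (2 * (m + 1 + α) * a / (1 - a ^ 2) - lowerResidue α m a +
          2 * r α (m + 1) a / a) -
        2 * (2 * α + 2 * m + 1) * r α (m + 1) a / (1 - a ^ 2)) a := by
  have hn := (normSq_pos hα ha m).ne'
  have ha0 : a ≠ 0 := ha.1.ne'
  have hw := (one_sub_sq_pos ha).ne'
  have hu := hasDerivAt_lower_eval hα ha m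
  have h := ((hu.mul hu).mul (hasDerivAt_rpow_div_normSq hα ha m)).const_mul 2
  refine (h.congr_of_eventuallyEq (Filter.Eventually.of_forall fun b => ?_)).congr_deriv ?_
  · simp only [Pi.mul_apply, lowerResidue]; ring
  · simp only [Pi.mul_apply, lowerResidue]
    rw [r_succ]
    field_simp
    ring

theorem hasDerivAt_recurrenceCoeff (ha : a ∈ Ioo (0 : ℝ) 1) (m : ℕ) :
    HasDerivAt (recurrenceCoeff α m)
      (lowerResidue α m a * recurrenceCoeff α m a - upperResidue α m a) a := by
  have hn := (normSq_pos hα ha m).ne'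
  refine ((hasDerivAt_normSq hα ha (m + 1)).div (hasDerivAt_normSq hα ha m) hn).congr_deriv ?_
  rw [lowerResidue, upperResidue, recurrenceCoeff]
  field_simp
  ring

end

/-! ### Elimination to the second order equation. -/

theorem contDiffOn_two_of_hasDerivAt {s : Set ℝ} (hs : IsOpen s) {f f' f'' : ℝ → ℝ}
    (h1 : ∀ x ∈ s, HasDerivAt f (f' x) x) (h2 : ∀ x ∈ s, HasDerivAt f' (f'' x) x)
    (h3 : ContinuousOn f'' s) :
    ContDiffOn ℝ 2 f s ∧ ∀ x ∈ s, deriv f x = f' x ∧ deriv (deriv f) x = f'' x := by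
  have hd1 : ∀ x ∈ s, deriv f x = f' x := fun x hx => (h1 x hx).deriv
  have hd2 : ∀ x ∈ s, deriv f' x = f'' x := fun x hx => (h2 x hx).deriv
  refine ⟨?_, fun x hx => ⟨hd1 x hx, ?_⟩⟩
  · rw [show (2 : WithTop ℕ∞) = 1 + 1 by norm_num, contDiffOn_succ_iff_deriv_of_isOpen hs]
    refine ⟨fun x hx => (h1 x hx).differentiableAt.differentiableWithinAt, by simp, ?_⟩
    refine ContDiffOn.congr ?_ hd1
    rw [show (1 : WithTop ℕ∞) = 0 + 1 by norm_num, contDiffOn_succ_iff_deriv_of_isOpen hs]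
    exact ⟨fun x hx => (h2 x hx).differentiableAt.differentiableWithinAt, by simp,
      contDiffOn_zero.2 (h3.congr hd2)⟩
  · have : deriv f =ᶠ[nhds x] f' := by
      filter_upwards [hs.mem_nhds hx] with y hy using hd1 y hy
    rw [this.deriv_eq, hd2 x hx]

/-- Move everything but `V * E` in `hD` to the other side and square, using `hV`. The difference of
squares supplies the multiplier of `hD`, so there is no division by `E`, which might vanish. -/
theorem secondOrderODE_of_sq_eq {α n a y y₁ y₂ V : ℝ}
    (hV : V ^ 2 = ((1 - a ^ 2) * y₁) ^ 2 +
      4 * y ^ 2 * ((n + y) * (n + 2 * α + y) - a ^ 2 * y ^ 2) + 4 * a ^ 2 * y ^ 4)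
    (hD : a * ((1 - a ^ 2) ^ 2 * y₂ - 2 * a * (1 - a ^ 2) * y₁) =
      (V - 2 * a * y ^ 2) * (2 * (n + α) * a ^ 2 + 2 * (1 + a ^ 2) * y) -
        a * (4 * y * ((n + y) * (n + 2 * α + y) - a ^ 2 * y ^ 2) +
          4 * (n + α) * (1 - a ^ 2) * y ^ 2)) :
    SecondOrderODE α n a y y₁ y₂ := by
  unfold SecondOrderODE
  linear_combination (a * ((1 - a ^ 2) ^ 2 * y₂ - 2 * a * (1 - a ^ 2) * y₁) +
      (V + 2 * a * y ^ 2) * (2 * (n + α) * a ^ 2 + 2 * (1 + a ^ 2) * y) +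
        a * (4 * y * ((n + y) * (n + 2 * α + y) - a ^ 2 * y ^ 2) +
          4 * (n + α) * (1 - a ^ 2) * y ^ 2)) * hD +
    (2 * (n + α) * a ^ 2 + 2 * (1 + a ^ 2) * y) ^ 2 * hV

/-- `r_n` is twice continuously differentiable and satisfies the second order equation. -/
theorem contDiffOn_r_and_secondOrderODE {α : ℝ} (hα : 0 < α) (m : ℕ) :
    ContDiffOn ℝ 2 (r α (m + 1)) (Ioo 0 1) ∧
      ∀ a ∈ Ioo (0 : ℝ) 1, SecondOrderODE α (m + 1) a (r α (m + 1) a)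
        (deriv (r α (m + 1)) a) (deriv (deriv (r α (m + 1))) a) := by
  set y := r α (m + 1)
  set X := upperResidue α m
  set R := lowerResidue α m
  set β := recurrenceCoeff α m
  set A : ℝ := 2 * α + 2 * m + 3 with hA
  set B : ℝ := 2 * α + 2 * m + 1 with hB
  -- `s` is `(1 - a^2) y'`, and `s'` is its derivative computed from the system.
  let s : ℝ → ℝ := fun a => A * β a * R a - B * X a
  let s' : ℝ → ℝ := fun a =>
    (A * β a * R a + B * X a) *
        (2 * (m + 1 + α) * a / (1 - a ^ 2) + 2 * y a / a) -
      4 * A * B * β a * y a / (1 - a ^ 2) - (A + B) * X a * R a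
  have hs : ∀ a ∈ Ioo (0 : ℝ) 1, HasDerivAt s (s' a) a := by
    intro a ha
    have h := (((hasDerivAt_recurrenceCoeff hα ha m).const_mul A).mul
      (hasDerivAt_lowerResidue hα ha m)).sub ((hasDerivAt_upperResidue hα ha m).const_mul B)
    refine h.congr_deriv ?_
    simp only [s', y, X, R, β, hA, hB]
    ring
  have hy : ∀ a ∈ Ioo (0 : ℝ) 1, HasDerivAt y (s a / (1 - a ^ 2)) a :=
    fun a ha => hasDerivAt_r hα ha m
  have hy' : ∀ a ∈ Ioo (0 : ℝ) 1, HasDerivAt (fun a => s a / (1 - a ^ 2))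
      ((s' a + 2 * a * s a / (1 - a ^ 2)) / (1 - a ^ 2)) a := by
    intro a ha
    have hw := (one_sub_sq_pos ha).ne'
    have h1 : HasDerivAt (fun x : ℝ => 1 - x ^ 2) (-(2 * a)) a := by
      simpa using ((hasDerivAt_pow 2 a).const_sub 1)
    refine ((hs a ha).div h1 hw).congr_deriv ?_
    field_simp
    ring
  have hcont : ContinuousOn (fun a => (s' a + 2 * a * s a / (1 - a ^ 2)) / (1 - a ^ 2))
      (Ioo (0 : ℝ) 1) := by
    intro a ha
    have hw := (one_sub_sq_pos ha).ne'
    have ha0 : a ≠ 0 := ha.1.ne'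
    have c1 : ContinuousAt y a := (hy a ha).continuousAt
    have c2 : ContinuousAt X a := (hasDerivAt_upperResidue hα ha m).continuousAt
    have c3 : ContinuousAt R a := (hasDerivAt_lowerResidue hα ha m).continuousAt
    have c4 : ContinuousAt β a := (hasDerivAt_recurrenceCoeff hα ha m).continuousAt
    refine ContinuousAt.continuousWithinAt ?_
    simp only [s, s']
    fun_prop (disch := assumption)
  obtain ⟨h1, h2⟩ := contDiffOn_two_of_hasDerivAt isOpen_Ioo hy hy' hcont
  refine ⟨h1, fun a ha => ?_⟩
  obtain ⟨e1, e2⟩ := h2 a ha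
  rw [e1, e2]
  have hw := (one_sub_sq_pos ha).ne'
  have ha0 : a ≠ 0 := ha.1.ne'
  have hXR : X a * R a = y a ^ 2 := upperResidue_mul_lowerResidue α m a
  have hrel : (m + 1 + y a) * (2 * α + m + 1 + y a) = (A * β a + a * X a) * (B + a * R a) :=
    residue_relation hα ha m
  -- Put `S = AβR + BX`. Then `S^2 = s^2 + 4ABβ y^2`, while `residue_relation` gives `ABβ` as an
  -- expression in `y` minus `a S`. The summand `2ay^2` completes the square in `S`.
  refine secondOrderODE_of_sq_eq (V := A * β a * R a + B * X a + 2 * a * y a ^ 2) ?_ ?_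
  · rw [mul_div_cancel₀ _ hw]
    simp only [s]
    linear_combination (4 * A * B * β a - 4 * a ^ 2 * y a ^ 2) * hXR - 4 * y a ^ 2 * hrel
  · have e3 : (1 - a ^ 2) ^ 2 * ((s' a + 2 * a * s a / (1 - a ^ 2)) / (1 - a ^ 2)) -
        2 * a * (1 - a ^ 2) * (s a / (1 - a ^ 2)) = (1 - a ^ 2) * s' a := by
      field_simp
      ring
    have e4 : a * ((1 - a ^ 2) * s' a) = (A * β a * R a + B * X a) *
        (2 * (m + 1 + α) * a ^ 2 + 2 * (1 - a ^ 2) * y a) - 4 * A * B * β a * y a * a -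
          (A + B) * a * (1 - a ^ 2) * X a * R a := by
      simp only [s']
      field_simp
    rw [e3, e4]
    linear_combination 4 * a * y a * hrel +
      (4 * a ^ 3 * y a - (A + B) * a * (1 - a ^ 2)) * hXR - (a * (1 - a ^ 2) * y a ^ 2) * (hA + hB)

/-! ### The change of variables `a = tanh (x/2)` and the Chazy form. -/

theorem tanh_half_mem_Ioo {x : ℝ} (hx : 0 < x) : Real.tanh (x / 2) ∈ Ioo (0 : ℝ) 1 := by
  refine ⟨?_, Real.tanh_lt_one _⟩
  rw [Real.tanh_eq_sinh_div_cosh]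
  exact div_pos (Real.sinh_pos_iff.2 (by linarith)) (Real.cosh_pos _)

theorem hasDerivAt_tanh_half (x : ℝ) :
    HasDerivAt (fun t => Real.tanh (t / 2)) ((1 - Real.tanh (x / 2) ^ 2) / 2) x := by
  have h := (Real.cosh_pos (x / 2)).ne'
  have h1 : HasDerivAt (fun t : ℝ => t / 2) (1 / 2) x := (hasDerivAt_id x).div_const 2
  simp only [Real.tanh_eq_sinh_div_cosh]
  refine (h1.sinh.div h1.cosh h).congr_deriv ?_
  field_simp

theorem one_sub_tanh_half_sq_mul_cosh (x : ℝ) :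
    (1 - Real.tanh (x / 2) ^ 2) * Real.cosh x = 1 + Real.tanh (x / 2) ^ 2 := by
  have h := (Real.cosh_pos (x / 2)).ne'
  have h1 := Real.cosh_sq (x / 2)
  have h2 : Real.cosh x = Real.cosh (x / 2) ^ 2 + Real.sinh (x / 2) ^ 2 := by
    rw [← Real.cosh_two_mul]; congr 1; ring
  rw [Real.tanh_eq_sinh_div_cosh, h2]
  field_simp
  linear_combination h1

theorem one_sub_tanh_half_sq_mul_sinh (x : ℝ) :
    (1 - Real.tanh (x / 2) ^ 2) * Real.sinh x = 2 * Real.tanh (x / 2) := by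
  have h := (Real.cosh_pos (x / 2)).ne'
  have h1 := Real.cosh_sq (x / 2)
  have h2 : Real.sinh x = 2 * Real.sinh (x / 2) * Real.cosh (x / 2) := by
    rw [← Real.sinh_two_mul]; congr 1; ring
  rw [Real.tanh_eq_sinh_div_cosh, h2]
  field_simp
  linear_combination Real.sinh (x / 2) * h1

/-- The hypotheses make `c = cosh x` and `s = sinh x` rational in `a`. Once the nonzero denominators
are cleared, the two equations differ by a constant factor. -/
theorem secondOrderODE_iff_real_chazy {α n a y y₁ y₂ c s : ℝ} (ha : a ∈ Ioo (0 : ℝ) 1)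
    (hc : (1 - a ^ 2) * c = 1 + a ^ 2) (hs : (1 - a ^ 2) * s = 2 * a) :
    SecondOrderODE α n a y y₁ y₂ ↔
      (y₂ * ((1 - a ^ 2) / 2) ^ 2 - y₁ * (a * (1 - a ^ 2) / 2) + 2 * (y + (n + α) / 2) ^ 3 -
          ((n + α) ^ 2 / 2 + α ^ 2) * (y + (n + α) / 2) + (n + α) * α ^ 2 / 2) ^ 2 =
        4 * (((y + (n + α) / 2) * c - (n + α) / 2) / s) ^ 2 *
          ((y₁ * ((1 - a ^ 2) / 2)) ^ 2 + (y + (n + α) / 2) ^ 4 -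
            ((n + α) ^ 2 / 2 + α ^ 2) * (y + (n + α) / 2) ^ 2 +
            (n + α) * α ^ 2 * (y + (n + α) / 2) +
            (n + α) ^ 2 * ((n + α) ^ 2 - 4 * α ^ 2) / 16) := by
  have hw := (one_sub_sq_pos ha).ne'
  have ha0 : a ≠ 0 := ha.1.ne'
  have e : ((y + (n + α) / 2) * c - (n + α) / 2) / s =
      (y * (1 + a ^ 2) + (n + α) * a ^ 2) / (2 * a) := by
    have h1 : c = (1 + a ^ 2) / (1 - a ^ 2) := by rw [← hc]; field_simp
    have h2 : s = 2 * a / (1 - a ^ 2) := by rw [← hs]; field_simp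
    rw [h1, h2]
    field_simp
    ring
  rw [e, ← sub_eq_zero]
  unfold SecondOrderODE
  constructor
  · intro h
    field_simp
    linear_combination 64 * h
  · intro h
    field_simp at h
    linear_combination h / 64

/-- Under `y = i u` each side becomes minus a real number, so the complex equation is a real one. -/
theorem complex_chazy_iff (A u u₁ c₁ c₂ c₃ k c s : ℝ) :
    (Complex.I * A - 2 * (Complex.I * u) ^ 3 - c₁ * (Complex.I * u) - -Complex.I * c₂) ^ 2 =
        -4 * ((Complex.I * u * c - Complex.I * k) / s) ^ 2 *
          ((Complex.I * u₁) ^ 2 - (Complex.I * u) ^ 4 - c₁ * (Complex.I * u) ^ 2 -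
            2 * (-Complex.I * c₂) * (Complex.I * u) - c₃) ↔
      (A + 2 * u ^ 3 - c₁ * u + c₂) ^ 2 = 4 * ((u * c - k) / s) ^ 2 *
        (u₁ ^ 2 + u ^ 4 - c₁ * u ^ 2 + 2 * c₂ * u + c₃) := by
  have hI3 : Complex.I ^ 3 = -Complex.I := by linear_combination Complex.I * Complex.I_sq
  have e0 : (Complex.I * u * c - Complex.I * k) / s = Complex.I * ((u * c - k) / s) := by ring
  have e1 : (Complex.I * A - 2 * (Complex.I * u) ^ 3 - c₁ * (Complex.I * u) - -Complex.I * c₂) ^ 2 =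
      ((-(A + 2 * u ^ 3 - c₁ * u + c₂) ^ 2 : ℝ) : ℂ) := by
    simp only [mul_pow, hI3]
    push_cast
    linear_combination ((A : ℂ) + 2 * u ^ 3 - c₁ * u + c₂) ^ 2 * Complex.I_sq
  have e2 : -4 * ((Complex.I * u * c - Complex.I * k) / s) ^ 2 *
          ((Complex.I * u₁) ^ 2 - (Complex.I * u) ^ 4 - c₁ * (Complex.I * u) ^ 2 -
            2 * (-Complex.I * c₂) * (Complex.I * u) - c₃) =
      ((-(4 * ((u * c - k) / s) ^ 2 *
        (u₁ ^ 2 + u ^ 4 - c₁ * u ^ 2 + 2 * c₂ * u + c₃)) : ℝ) : ℂ) := by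
    rw [e0]
    simp only [mul_pow, Complex.I_sq, Complex.I_pow_four]
    push_cast
    linear_combination 8 * (((u : ℂ) * c - k) / s) ^ 2 * c₂ * u * Complex.I_sq
  rw [e1, e2, Complex.ofReal_inj, neg_inj]

/-- The change of variables `y(x) = i (f(tanh (x / 2)) + N / 2)`, `N = n + α`, turns the second
order equation into the fourth member of the Chazy II system. -/
theorem secondOrderODE_iff_chazyIIFourth (α n : ℝ) {f : ℝ → ℝ} (hf : ContDiffOn ℝ 2 f (Ioo 0 1))
    {x : ℝ} (hx : 0 < x) :
    SecondOrderODE α n (Real.tanh (x / 2)) (f (Real.tanh (x / 2)))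
        (deriv f (Real.tanh (x / 2))) (deriv (deriv f) (Real.tanh (x / 2))) ↔
      ChazyIIFourth
        (((n + α) ^ 2 / 2 + α ^ 2 : ℝ) : ℂ)
        (-Complex.I * ((n + α) * α ^ 2 / 2 : ℝ))
        (((n + α) ^ 2 * ((n + α) ^ 2 - 4 * α ^ 2) / 16 : ℝ) : ℂ)
        (Complex.I * ((n + α) / 2 : ℝ))
        (fun t : ℝ => Complex.I * (f (Real.tanh (t / 2)) + (n + α) / 2 : ℝ)) x := by
  rw [show (2 : WithTop ℕ∞) = 1 + 1 by norm_num,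
    contDiffOn_succ_iff_deriv_of_isOpen isOpen_Ioo] at hf
  have hf1 : ∀ a ∈ Ioo (0 : ℝ) 1, HasDerivAt f (deriv f a) a := fun a ha =>
    ((hf.1 a ha).differentiableAt (isOpen_Ioo.mem_nhds ha)).hasDerivAt
  have hf2 : ∀ a ∈ Ioo (0 : ℝ) 1, HasDerivAt (deriv f) (deriv (deriv f) a) a := fun a ha =>
    (((hf.2.2.differentiableOn (by norm_num)) a ha).differentiableAt
      (isOpen_Ioo.mem_nhds ha)).hasDerivAt
  set T : ℝ → ℝ := fun t => Real.tanh (t / 2) with hT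
  have hTd : ∀ t, HasDerivAt T ((1 - T t ^ 2) / 2) t := hasDerivAt_tanh_half
  have hTm : ∀ t, 0 < t → T t ∈ Ioo (0 : ℝ) 1 := fun t ht => tanh_half_mem_Ioo ht
  have h1 : ∀ t, 0 < t → HasDerivAt (fun t : ℝ => Complex.I * (f (T t) + (n + α) / 2 : ℝ))
      (Complex.I * (deriv f (T t) * ((1 - T t ^ 2) / 2) : ℝ)) t := fun t ht =>
    ((((hf1 _ (hTm t ht)).comp t (hTd t)).add_const ((n + α) / 2)).ofReal_comp).const_mul Complex.I
  have h2 : HasDerivAt (fun t : ℝ => Complex.I * (deriv f (T t) * ((1 - T t ^ 2) / 2) : ℝ))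
      (Complex.I * (deriv (deriv f) (T x) * ((1 - T x ^ 2) / 2) ^ 2 -
        deriv f (T x) * (T x * (1 - T x ^ 2) / 2) : ℝ)) x := by
    have h3 := (((hf2 _ (hTm x hx)).comp x (hTd x)).mul
      ((((hTd x).pow 2).const_sub 1).div_const 2)).ofReal_comp.const_mul Complex.I
    refine h3.congr_deriv ?_
    congr 2
    simp only [Function.comp, Pi.pow_apply]
    push_cast
    ring
  have d1 := (h1 x hx).deriv
  have d2 : deriv (deriv fun t : ℝ => Complex.I * (f (T t) + (n + α) / 2 : ℝ)) x =
      Complex.I * (deriv (deriv f) (T x) * ((1 - T x ^ 2) / 2) ^ 2 -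
        deriv f (T x) * (T x * (1 - T x ^ 2) / 2) : ℝ) := by
    -- The formula for the first derivative is known only for `t > 0`, hence equality near `x`.
    have : deriv (fun t : ℝ => Complex.I * (f (T t) + (n + α) / 2 : ℝ)) =ᶠ[nhds x]
        fun t : ℝ => Complex.I * (deriv f (T t) * ((1 - T t ^ 2) / 2) : ℝ) := by
      filter_upwards [isOpen_Ioi.mem_nhds hx] with t ht using (h1 t ht).deriv
    rw [this.deriv_eq, h2.deriv]
  rw [ChazyIIFourth, d1, d2, secondOrderODE_iff_real_chazy (hTm x hx)
    (one_sub_tanh_half_sq_mul_cosh x) (one_sub_tanh_half_sq_mul_sinh x)]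
  rw [complex_chazy_iff, mul_div_cancel₀ _ (two_ne_zero' ℝ)]

end JacobiGap

end

theorem mainTheorem4 (α : ℝ) (hα : 0 < α) (n : ℕ) (hn : 1 ≤ n) :
    (ContDiffOn ℝ 2 (JacobiGap.r α n) (Set.Ioo 0 1) ∧
      ∀ a ∈ Set.Ioo (0 : ℝ) 1,
        JacobiGap.SecondOrderODE α n a (JacobiGap.r α n a)
          (deriv (JacobiGap.r α n) a) (deriv (deriv (JacobiGap.r α n)) a)) ∧
    ∀ f : ℝ → ℝ, ContDiffOn ℝ 2 f (Set.Ioo 0 1) →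
      ((∀ a ∈ Set.Ioo (0 : ℝ) 1,
          JacobiGap.SecondOrderODE α n a (f a) (deriv f a) (deriv (deriv f) a)) ↔
        ∀ x : ℝ, 0 < x →
          JacobiGap.ChazyIIFourth
            (((n + α) ^ 2 / 2 + α ^ 2 : ℝ) : ℂ)
            (-Complex.I * ((n + α) * α ^ 2 / 2 : ℝ))
            (((n + α) ^ 2 * ((n + α) ^ 2 - 4 * α ^ 2) / 16 : ℝ) : ℂ)
            (Complex.I * ((n + α) / 2 : ℝ))
            (fun t : ℝ => Complex.I * (f (Real.tanh (t / 2)) + (n + α) / 2 : ℝ)) x) := by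
  refine ⟨?_, fun f hf => ⟨fun h x hx => ?_, fun h a ha => ?_⟩⟩
  · obtain ⟨m, rfl⟩ : ∃ m, n = m + 1 := ⟨n - 1, by omega⟩
    rw [Nat.cast_succ]
    exact JacobiGap.contDiffOn_r_and_secondOrderODE hα m
  · exact (JacobiGap.secondOrderODE_iff_chazyIIFourth α n hf hx).1
      (h _ (JacobiGap.tanh_half_mem_Ioo hx))
  -- The equivalence is pointwise, and every `a` in `(0, 1)` is reached from `x = 2 artanh a`.
  · have hx : 0 < 2 * Real.artanh a := by linarith [Real.artanh_pos ha]
    have h1 := (JacobiGap.secondOrderODE_iff_chazyIIFourth α n hf hx).2 (h _ hx)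
    rwa [mul_div_cancel_left₀ _ (two_ne_zero' ℝ),
      Real.tanh_artanh ⟨by linarith [ha.1], ha.2⟩] at h1
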